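/- **Theorem 2.4.** Let $k$ be a commutative ring and $H$ a weak bialgebra over $k$: a $k$-algebra and $k$-coalgebra such that $\Delta(hg)=\Delta(h)\Delta(g)$, $$(\mathrm{id}\otimes\Delta)\Delta(1)=(\Delta(1)\otimes 1)(1\otimes\Delta(1))=(1\otimes\Delta(1))(\Delta(1)\otimes 1),$$ $$\varepsilon(hgl)=\varepsilon(hg_{(1)})\,\varepsilon(g_{(2)}l)=\varepsilon(hg_{(2)})\,\varepsilon(g_{(1)}l)\qquad(h,g,l\in H).$$ Put $\varepsilon_t(h)=\varepsilon(1_{(1)}h)1_{(2)}$, $\varepsilon_s(h)=1_{(1)}\varepsilon(h1_{(2)})$, $\overline{\varepsilon}_s(h)=\varepsilon(1_{(2)}h)1_{(1)}$ and $H_t=\varepsilon_t(H)$. The category ${}_H\mathcal M$ of left $H$-modules is monoidal, with tensor product $$M\otimes_t N=\Delta(1)(M\otimes_k N),\qquad h(m\otimes n)=h_{(1)}m\otimes h_{(2)}n,$$ with unit object $H_t$ on which $H$ acts by $h\rightharpoonup z=\varepsilon_t(hz)$, with the natural associativity constraints, and with unit constraints given by the restrictions of $z\otimes m\mapsto zm$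 to $H_t\otimes_t M\to M$ and of $m\otimes z\mapsto\overline{\varepsilon}_s(z)m$ to $M\otimes_t H_t\to M$. A left-left Yetter-Drinfeld module over $H$ is a left $H$-module $M$ together with a coassociative and counital left $H$-coaction $\lambda(m)=m_{[-1]}\otimes m_{[0]}$ such that, for all $h\in H$ and $m\in M$, $$\lambda(m)\in H\otimes_t M,\qquad h_{(1)}m_{[-1]}\otimes h_{(2)}m_{[0]}=(h_{(1)}m)_{[-1]}h_{(2)}\otimes(h_{(1)}m)_{[0]}.$$ With the left $H$-linear, left $H$-colinear maps as morphisms, these form the category ${}_H^H\mathcal{YD}$. The weak left center $\mathcal W_l(\mathcal C)$ of a monoidal category $(\mathcal C,\otimes,I,a,l,r)$ has as objects the pairs $(M,\sigma)$ where $M\in\mathcal C$ and $\sigma_X:M\otimes X\to X\otimes M$ is a natural transformation (not necessarily invertible) with $$(X\otimes\sigma_Y)\circ a_{X,M,Y}\circ(\sigma_X\otimes Y)=a_{X,Y,M}\circ\sigma_{X\otimes Y}\circ a_{M,X,Y}\quad(X,Y\in\mathcal C),\qquad \sigma_I=l_M^{-1}\circ r_M.$$ A morphism $(M,\sigma)\to(M',\sigma')$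 is a morphism $\vartheta:M\to M'$ in $\mathcal C$ with $(X\otimes\vartheta)\circ\sigma_X=\sigma'_X\circ(\vartheta\otimes X)$ for all $X$. The left center $\mathcal Z_l(\mathcal C)$ is the full subcategory of $\mathcal W_l(\mathcal C)$ of the objects $(M,\sigma)$ with $\sigma$ a natural isomorphism. 1. The category ${}_H^H\mathcal{YD}$ is isomorphic to the weak left center $\mathcal W_l({}_H\mathcal M)$. 2. If $H$ is a weak Hopf algebra with bijective antipode, that is, if there is a bijective $k$-linear map $S:H\to H$ with $S*\mathrm{id}=\varepsilon_s$, $\mathrm{id}*S=\varepsilon_t$ and $S*\mathrm{id}*S=S$ for the convolution product $*$, then ${}_H^H\mathcal{YD}$ is isomorphic to the left center $\mathcal Z_l({}_H\mathcal M)$. -/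

import Mathlib

open CategoryTheory MonoidalCategory
open scoped TensorProduct

universe u v

namespace WeakBialg

noncomputable section

/-! ## Weak bialgebras and weak Hopf algebras -/

section Algebra

variable (k : Type u) (H : Type v) [CommRing k] [Ring H] [Algebra k H] [Coalgebra k H]

/-- A weak bialgebra over a commutative ring `k`: a `k`-algebra and `k`-coalgebra `H` such that
`Δ` is multiplicative (but not necessarily unital), with weak comultiplicativity of the unit
`Δ²(1) = (Δ(1) ⊗ 1)(1 ⊗ Δ(1)) = (1 ⊗ Δ(1))(Δ(1) ⊗ 1)` in `H ⊗ H ⊗ H` and weak multiplicativity of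
the counit `ε(xyz) = ε(x y₍₁₎) ε(y₍₂₎ z) = ε(x y₍₂₎) ε(y₍₁₎ z)`. -/
class IsWeakBialgebra : Prop where
  comul_mul : ∀ x y : H,
    Coalgebra.comul (R := k) (x * y) = Coalgebra.comul (R := k) x * Coalgebra.comul (R := k) y
  comul_comul_one :
    LinearMap.lTensor H (Coalgebra.comul (R := k) (A := H)) (Coalgebra.comul (R := k) (1 : H)) =
      TensorProduct.assoc k H H H (Coalgebra.comul (R := k) (1 : H) ⊗ₜ[k] (1 : H)) *
        ((1 : H) ⊗ₜ[k] Coalgebra.comul (R := k) (1 : H))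
  comul_comul_one' :
    LinearMap.lTensor H (Coalgebra.comul (R := k) (A := H)) (Coalgebra.comul (R := k) (1 : H)) =
      ((1 : H) ⊗ₜ[k] Coalgebra.comul (R := k) (1 : H)) *
        TensorProduct.assoc k H H H (Coalgebra.comul (R := k) (1 : H) ⊗ₜ[k] (1 : H))
  counit_mul_mul : ∀ x y z : H,
    Coalgebra.counit (R := k) (x * y * z) =
      LinearMap.mul' k k (TensorProduct.map
        (Coalgebra.counit (R := k) ∘ₗ LinearMap.mulLeft k x)
        (Coalgebra.counit (R := k) ∘ₗ LinearMap.mulRight k z) (Coalgebra.comul (R := k) y))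
  counit_mul_mul' : ∀ x y z : H,
    Coalgebra.counit (R := k) (x * y * z) =
      LinearMap.mul' k k (TensorProduct.map
        (Coalgebra.counit (R := k) ∘ₗ LinearMap.mulLeft k x)
        (Coalgebra.counit (R := k) ∘ₗ LinearMap.mulRight k z)
        (TensorProduct.comm k H H (Coalgebra.comul (R := k) y)))

variable {H}

/-- `p ⊗ q ↦ ε(p g) q`. -/
def evL (g : H) : H ⊗[k] H →ₗ[k] H :=
  (TensorProduct.lid k H).toLinearMap ∘ₗ
    LinearMap.rTensor H (Coalgebra.counit (R := k) ∘ₗ LinearMap.mulRight k g)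

/-- `p ⊗ q ↦ ε(q g) p`. -/
def evR (g : H) : H ⊗[k] H →ₗ[k] H :=
  (TensorProduct.rid k H).toLinearMap ∘ₗ
    LinearMap.lTensor H (Coalgebra.counit (R := k) ∘ₗ LinearMap.mulRight k g)

variable (H)

/-- The target map `ε_t(h) = ε(1₍₁₎ h) 1₍₂₎`. -/
def targetMap : H →ₗ[k] H where
  toFun h := evL k h (Coalgebra.comul (R := k) (1 : H))
  map_add' x y := by
    induction Coalgebra.comul (R := k) (1 : H) using TensorProduct.induction_on with
    | zero => simp
    | tmul a b => simp [evL, mul_add, add_smul]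
    | add s t hs ht => simp only [map_add, hs, ht]; abel
  map_smul' c x := by
    induction Coalgebra.comul (R := k) (1 : H) using TensorProduct.induction_on with
    | zero => simp
    | tmul a b => simp [evL, mul_smul]
    | add s t hs ht => simp only [map_add, hs, ht, smul_add]

/-- The source map `ε_s(h) = 1₍₁₎ ε(h 1₍₂₎)`. -/
def sourceMap : H →ₗ[k] H where
  toFun h := TensorProduct.rid k H
    (LinearMap.lTensor H (Coalgebra.counit (R := k) ∘ₗ LinearMap.mulLeft k h)
      (Coalgebra.comul (R := k) (1 : H)))
  map_add' x y := by
    induction Coalgebra.comul (R := k) (1 : H) using TensorProduct.induction_on with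
    | zero => simp
    | tmul a b => simp [add_mul, add_smul]
    | add s t hs ht => simp only [map_add, hs, ht]; abel
  map_smul' c x := by
    induction Coalgebra.comul (R := k) (1 : H) using TensorProduct.induction_on with
    | zero => simp
    | tmul a b => simp [mul_smul]
    | add s t hs ht => simp only [map_add, hs, ht, smul_add]

/-- The source map of `H` with opposite multiplication, `h ↦ ε(1₍₂₎ h) 1₍₁₎`. -/
def sourceMapOp : H →ₗ[k] H where
  toFun h := evR k h (Coalgebra.comul (R := k) (1 : H))
  map_add' x y := by
    induction Coalgebra.comul (R := k) (1 : H) using TensorProduct.induction_on with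
    | zero => simp
    | tmul a b => simp [evR, mul_add, add_smul]
    | add s t hs ht => simp only [map_add, hs, ht]; abel
  map_smul' c x := by
    induction Coalgebra.comul (R := k) (1 : H) using TensorProduct.induction_on with
    | zero => simp
    | tmul a b => simp [evR, mul_smul]
    | add s t hs ht => simp only [map_add, hs, ht, smul_add]

variable {H}

/-- The convolution product `(f * g)(h) = f(h₍₁₎) g(h₍₂₎)`. -/
def conv (f g : H →ₗ[k] H) : H →ₗ[k] H :=
  LinearMap.mul' k H ∘ₗ TensorProduct.map f g ∘ₗ Coalgebra.comul (R := k)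

/-- `S` is an antipode of the weak bialgebra `H`. -/
structure IsAntipode (S : H →ₗ[k] H) : Prop where
  conv_left : conv k S LinearMap.id = sourceMap k H
  conv_right : conv k LinearMap.id S = targetMap k H
  conv_conv : conv k (conv k S LinearMap.id) S = S

end Algebra

/-! ## Elementary identities in a weak bialgebra -/

section Identities

variable {k : Type u} {H : Type v} [CommRing k] [Ring H] [Algebra k H] [Coalgebra k H]

local notation "Δ" => Coalgebra.comul (R := k) (A := H)
local notation "ε" => Coalgebra.counit (R := k) (A := H)

@[simp] lemma evL_tmul (g p q : H) : evL k g (p ⊗ₜ[k] q) = ε (p * g) • q := by simp [evL]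

@[simp] lemma evR_tmul (g p q : H) : evR k g (p ⊗ₜ[k] q) = ε (q * g) • p := by simp [evR]

lemma targetMap_apply (g : H) : targetMap k H g = evL k g (Δ 1) := rfl

lemma sourceMapOp_apply (g : H) : sourceMapOp k H g = evR k g (Δ 1) := rfl

lemma evL_one_comul (h : H) : evL k 1 (Δ h) = h := by
  simp [evL]

lemma evR_one_comul (h : H) : evR k 1 (Δ h) = h := by
  simp [evR]

lemma evL_congr {g g' : H} (h : ∀ x : H, ε (x * g) = ε (x * g')) (s : H ⊗[k] H) :
    evL k g s = evL k g' s := by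
  induction s using TensorProduct.induction_on with
  | zero => simp
  | add r r' hr hr' => simp only [map_add, hr, hr']
  | tmul c d => simp [h]

lemma evR_congr {g g' : H} (h : ∀ x : H, ε (x * g) = ε (x * g')) (s : H ⊗[k] H) :
    evR k g s = evR k g' s := by
  induction s using TensorProduct.induction_on with
  | zero => simp
  | add r r' hr hr' => simp only [map_add, hr, hr']
  | tmul c d => simp [h]

lemma targetMap_one : targetMap k H (1 : H) = 1 := evL_one_comul 1

lemma sourceMapOp_one : sourceMapOp k H (1 : H) = 1 := evR_one_comul 1

variable [IsWeakBialgebra k H]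

lemma comul_mul (x y : H) : Δ (x * y) = Δ x * Δ y := IsWeakBialgebra.comul_mul x y

lemma counit_mul_eq (x z : H) : ε (x * z) =
    LinearMap.mul' k k (TensorProduct.map
      (ε ∘ₗ LinearMap.mulLeft k x) (ε ∘ₗ LinearMap.mulRight k z) (Δ 1)) := by
  simpa using IsWeakBialgebra.counit_mul_mul (k := k) x 1 z

lemma counit_mul_eq' (x z : H) : ε (x * z) =
    LinearMap.mul' k k (TensorProduct.map
      (ε ∘ₗ LinearMap.mulLeft k x) (ε ∘ₗ LinearMap.mulRight k z)
      (TensorProduct.comm k H H (Δ 1))) := by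
  simpa using IsWeakBialgebra.counit_mul_mul' (k := k) x 1 z

lemma evL_comul (h g : H) : evL k g (Δ h) = h * targetMap k H g := by
  let Φ : H ⊗[k] H → H ⊗[k] (H ⊗[k] H) →ₗ[k] H := fun s =>
    (TensorProduct.lid k H).toLinearMap ∘ₗ
      TensorProduct.map (ε ∘ₗ LinearMap.mulRight k g) (evL k 1 ∘ₗ LinearMap.mulLeft k s)
  have hΦ : ∀ s x y, Φ s (x ⊗ₜ y) = ε (x * g) • evL k 1 (s * y) := by intro s x y; simp [Φ]
  have hΦadd : ∀ s t, Φ (s + t) = Φ s + Φ t := by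
    intro s t; apply TensorProduct.ext'; intro x y
    simp [hΦ, add_mul]
  have hΦzero : Φ 0 = 0 := by apply TensorProduct.ext'; intro x y; simp [hΦ]
  have key : ∀ s t : H ⊗[k] H, evL k g (s * t) =
      Φ s ((1 ⊗ₜ t) * TensorProduct.assoc k H H H (Δ 1 ⊗ₜ 1)) := by
    intro s t
    induction s using TensorProduct.induction_on with
    | zero => simp [hΦzero]
    | add s s' hs hs' => simp only [add_mul, map_add, hs, hs', hΦadd, LinearMap.add_apply]
    | tmul p q =>
      induction t using TensorProduct.induction_on with
      | zero => simp
      | add t t' ht ht' =>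
        simp only [mul_add, map_add, ht, ht', TensorProduct.tmul_add, add_mul]
      | tmul a b =>
        rw [Algebra.TensorProduct.tmul_mul_tmul, evL_tmul, counit_mul_eq']
        induction Δ (1 : H) using TensorProduct.induction_on with
        | zero => simp
        | add r r' hr hr' =>
          simp only [map_add, hr, hr', TensorProduct.add_tmul, mul_add, add_smul]
        | tmul c d =>
          simp [hΦ, smul_smul, mul_comm]
  have h1 : Δ h = Δ h * Δ 1 := by rw [← comul_mul, mul_one]
  rw [h1, key, ← IsWeakBialgebra.comul_comul_one', targetMap_apply]
  induction Δ (1 : H) using TensorProduct.induction_on with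
  | zero => simp
  | add r r' hr hr' => simp only [map_add, hr, hr', mul_add]
  | tmul c d =>
    rw [LinearMap.lTensor_tmul, hΦ, ← comul_mul, evL_one_comul, evL_tmul, mul_smul_comm]

lemma evR_comul (h g : H) : evR k g (Δ h) = h * sourceMapOp k H g := by
  let Φ : H ⊗[k] H → (H ⊗[k] H) ⊗[k] H →ₗ[k] H := fun s =>
    (TensorProduct.rid k H).toLinearMap ∘ₗ
      TensorProduct.map (evR k 1 ∘ₗ LinearMap.mulLeft k s) (ε ∘ₗ LinearMap.mulRight k g)
  have hΦ : ∀ s x y, Φ s (x ⊗ₜ y) = ε (y * g) • evR k 1 (s * x) := by intro s x y; simp [Φ]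
  have hΦadd : ∀ s t, Φ (s + t) = Φ s + Φ t := by
    intro s t; apply TensorProduct.ext'; intro x y
    simp [hΦ, add_mul]
  have hΦzero : Φ 0 = 0 := by apply TensorProduct.ext'; intro x y; simp [hΦ]
  have key : ∀ s t : H ⊗[k] H, evR k g (s * t) =
      Φ s ((TensorProduct.assoc k H H H).symm
        (TensorProduct.assoc k H H H (t ⊗ₜ 1) * (1 ⊗ₜ Δ 1))) := by
    intro s t
    induction s using TensorProduct.induction_on with
    | zero => simp [hΦzero]
    | add s s' hs hs' => simp only [add_mul, map_add, hs, hs', hΦadd, LinearMap.add_apply]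
    | tmul p q =>
      induction t using TensorProduct.induction_on with
      | zero => simp
      | add t t' ht ht' =>
        simp only [mul_add, map_add, ht, ht', TensorProduct.add_tmul, add_mul]
      | tmul a b =>
        rw [Algebra.TensorProduct.tmul_mul_tmul, evR_tmul, counit_mul_eq]
        induction Δ (1 : H) using TensorProduct.induction_on with
        | zero => simp
        | add r r' hr hr' =>
          simp only [map_add, hr, hr', TensorProduct.tmul_add, mul_add, add_smul]
        | tmul c d =>
          simp [hΦ, smul_smul, mul_comm]
  have h1 : Δ h = Δ h * Δ 1 := by rw [← comul_mul, mul_one]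
  rw [h1, key, ← IsWeakBialgebra.comul_comul_one, Coalgebra.coassoc_symm_apply,
    sourceMapOp_apply]
  induction Δ (1 : H) using TensorProduct.induction_on with
  | zero => simp
  | add r r' hr hr' => simp only [map_add, hr, hr', mul_add]
  | tmul c d =>
    rw [LinearMap.rTensor_tmul, hΦ, ← comul_mul, evR_one_comul, evR_tmul, mul_smul_comm]

lemma counit_mul_targetMap (h g : H) : ε (h * targetMap k H g) = ε (h * g) := by
  rw [counit_mul_eq' h g, targetMap_apply]
  induction Δ (1 : H) using TensorProduct.induction_on with
  | zero => simp
  | add r r' hr hr' => simp only [map_add, hr, hr', mul_add]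
  | tmul c d => simp [mul_comm]

lemma counit_mul_sourceMapOp (h g : H) : ε (h * sourceMapOp k H g) = ε (h * g) := by
  rw [counit_mul_eq h g, sourceMapOp_apply]
  induction Δ (1 : H) using TensorProduct.induction_on with
  | zero => simp
  | add r r' hr hr' => simp only [map_add, hr, hr', mul_add]
  | tmul c d => simp [mul_comm]

lemma targetMap_mul_targetMap (h g : H) :
    targetMap k H (h * targetMap k H g) = targetMap k H (h * g) :=
  evL_congr (fun x => by rw [← mul_assoc, counit_mul_targetMap, mul_assoc]) _

lemma targetMap_targetMap (g : H) : targetMap k H (targetMap k H g) = targetMap k H g := by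
  simpa using targetMap_mul_targetMap (k := k) 1 g

lemma targetMap_sourceMapOp (g : H) : targetMap k H (sourceMapOp k H g) = targetMap k H g :=
  evL_congr (fun x => counit_mul_sourceMapOp x g) _

lemma sourceMapOp_targetMap (g : H) : sourceMapOp k H (targetMap k H g) = sourceMapOp k H g :=
  evR_congr (fun x => counit_mul_targetMap x g) _

/-- `1₍₁₎ ⊗ 1₍₂₎ ε_t(g) = 1₍₁₎ ε̄_s(g) ⊗ 1₍₂₎`. -/
lemma comul_one_mul_targetMap (g : H) :
    Δ 1 * (1 ⊗ₜ targetMap k H g) = Δ 1 * (sourceMapOp k H g ⊗ₜ 1) := by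
  have h1 : ∀ s : H ⊗[k] H, s * (1 ⊗ₜ targetMap k H g) =
      LinearMap.lTensor H (evL k g) (LinearMap.lTensor H Δ s) := by
    intro s
    induction s using TensorProduct.induction_on with
    | zero => simp
    | add r r' hr hr' => simp only [map_add, hr, hr', add_mul]
    | tmul c d => simp [evL_comul]
  have h2 : ∀ s : H ⊗[k] H, s * (sourceMapOp k H g ⊗ₜ 1) =
      LinearMap.rTensor H (evR k g) (LinearMap.rTensor H Δ s) := by
    intro s
    induction s using TensorProduct.induction_on with
    | zero => simp
    | add r r' hr hr' => simp only [map_add, hr, hr', add_mul]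
    | tmul c d => simp [evR_comul]
  have h3 : ∀ t : (H ⊗[k] H) ⊗[k] H, LinearMap.lTensor H (evL k g) (TensorProduct.assoc k H H H t) =
      LinearMap.rTensor H (evR k g) t := by
    intro t
    induction t using TensorProduct.induction_on with
    | zero => simp
    | add r r' hr hr' => simp only [map_add, hr, hr']
    | tmul s d =>
      induction s using TensorProduct.induction_on with
      | zero => simp
      | add r r' hr hr' => simp only [map_add, hr, hr', TensorProduct.add_tmul]
      | tmul a b => simp [TensorProduct.smul_tmul]
  rw [h1, h2, ← Coalgebra.coassoc_apply, h3]

end Identities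

/-! ## The category of left modules -/

section Modules

/-- A left module over the `k`-algebra `H`.  The `k`-module structure is carried along, although it
is determined by the `H`-module structure, via `c • m = (c • 1) • m`. -/
structure LMod (k : Type u) (H : Type v) [CommRing k] [Ring H] [Algebra k H] where
  /-- the underlying type -/
  carrier : Type v
  [addCommGroup : AddCommGroup carrier]
  [modulek : Module k carrier]
  [moduleH : Module H carrier]
  [isScalarTower : IsScalarTower k H carrier]

attribute [instance] LMod.addCommGroup LMod.modulek LMod.moduleH LMod.isScalarTower

variable {k : Type u} {H : Type v} [CommRing k] [Ring H] [Algebra k H]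

instance : CoeSort (LMod k H) (Type v) := ⟨LMod.carrier⟩

/-- Morphisms of left `H`-modules are the `H`-linear maps. -/
@[ext]
structure LMod.Hom (M N : LMod k H) where
  /-- the underlying linear map -/
  hom : M →ₗ[H] N

instance : Category (LMod k H) where
  Hom M N := LMod.Hom M N
  id _ := ⟨LinearMap.id⟩
  comp f g := ⟨g.hom ∘ₗ f.hom⟩

@[ext]
lemma LMod.hom_ext {M N : LMod k H} {f g : M ⟶ N} (h : f.hom = g.hom) : f = g :=
  LMod.Hom.ext h

@[simp] lemma LMod.id_hom (M : LMod k H) : LMod.Hom.hom (𝟙 M) = LinearMap.id := rfl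

@[simp] lemma LMod.comp_hom {M N P : LMod k H} (f : M ⟶ N) (g : N ⟶ P) :
    (f ≫ g).hom = g.hom ∘ₗ f.hom := rfl

/-- An `H`-linear equivalence gives an isomorphism of left `H`-modules. -/
@[simps]
def LMod.isoOfEquiv {M N : LMod k H} (e : M ≃ₗ[H] N) : M ≅ N where
  hom := ⟨e.toLinearMap⟩
  inv := ⟨e.symm.toLinearMap⟩
  hom_inv_id := by ext; simp
  inv_hom_id := by ext; simp

end Modules

/-! ## The tensor product of left modules -/

section Tensor

variable {k : Type u} {H : Type v} [CommRing k] [Ring H] [Algebra k H]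

/-- The action of `A ⊗ B` on `X ⊗ Y` when `A` acts on `X` and `B` acts on `Y`. -/
def tensorAct {A B X Y : Type v} [Ring A] [Algebra k A] [Ring B] [Algebra k B]
    [AddCommGroup X] [Module k X] [AddCommGroup Y] [Module k Y]
    (f : A →ₐ[k] Module.End k X) (g : B →ₐ[k] Module.End k Y) :
    A ⊗[k] B →ₐ[k] Module.End k (X ⊗[k] Y) :=
  (Module.endTensorEndAlgHom (R := k) (S := k) (A := k) (M := X) (N := Y)).comp
    (Algebra.TensorProduct.map f g)

@[simp] lemma tensorAct_tmul {A B X Y : Type v} [Ring A] [Algebra k A] [Ring B] [Algebra k B]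
    [AddCommGroup X] [Module k X] [AddCommGroup Y] [Module k Y]
    (f : A →ₐ[k] Module.End k X) (g : B →ₐ[k] Module.End k Y) (a : A) (b : B) (x : X) (y : Y) :
    tensorAct f g (a ⊗ₜ b) (x ⊗ₜ y) = f a x ⊗ₜ g b y := rfl

section

variable (M N P : Type v) [AddCommGroup M] [Module k M] [Module H M] [IsScalarTower k H M]
  [AddCommGroup N] [Module k N] [Module H N] [IsScalarTower k H N]
  [AddCommGroup P] [Module k P] [Module H P] [IsScalarTower k H P]

/-- The action of `H ⊗ H` on `M ⊗ N`, `(a ⊗ b) (m ⊗ n) = a m ⊗ b n`. -/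
def act : H ⊗[k] H →ₐ[k] Module.End k (M ⊗[k] N) :=
  tensorAct (Algebra.lsmul k k M) (Algebra.lsmul k k N)

@[simp] lemma act_tmul (a b : H) (m : M) (n : N) :
    act (k := k) M N (a ⊗ₜ b) (m ⊗ₜ n) = (a • m) ⊗ₜ (b • n) := rfl

variable (k H) [Coalgebra k H]

/-- `M ⊗_t N = Δ(1)(M ⊗ N)`, a submodule of `M ⊗ N`. -/
def tensorT : Submodule k (M ⊗[k] N) :=
  LinearMap.range (act (k := k) (H := H) M N (Coalgebra.comul (R := k) (1 : H)))

variable {k H M N P} [IsWeakBialgebra k H]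

local notation "Δ" => Coalgebra.comul (R := k) (A := H)

lemma comul_one_mul (h : H) : Δ 1 * Δ h = Δ h := by rw [← comul_mul, one_mul]

lemma act_comul_mem (h : H) (x : M ⊗[k] N) : act M N (Δ h) x ∈ tensorT k H M N :=
  ⟨act M N (Δ h) x, by rw [← Module.End.mul_apply, ← map_mul, comul_one_mul]⟩

lemma act_comul_one_of_mem {x : M ⊗[k] N} (hx : x ∈ tensorT k H M N) :
    act M N (Δ 1) x = x := by
  obtain ⟨y, rfl⟩ := hx
  rw [← Module.End.mul_apply, ← map_mul, comul_one_mul]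

variable (k H M N) in
/-- `M ⊗_t N`, as a type. -/
def TensorT : Type v := ↥(tensorT k H M N)

instance : AddCommGroup (TensorT k H M N) := inferInstanceAs (AddCommGroup ↥(tensorT k H M N))

instance : Module k (TensorT k H M N) := inferInstanceAs (Module k ↥(tensorT k H M N))

variable (k H M N) in
/-- The inclusion `M ⊗_t N → M ⊗ N`. -/
def incl : TensorT k H M N →ₗ[k] M ⊗[k] N := (tensorT k H M N).subtype

lemma incl_injective : Function.Injective (incl k H M N) := Subtype.val_injective

lemma incl_ext {x y : TensorT k H M N} (h : incl k H M N x = incl k H M N y) : x = y :=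
  incl_injective h

lemma act_comul_one_incl (x : TensorT k H M N) :
    act M N (Δ 1) (incl k H M N x) = incl k H M N x := act_comul_one_of_mem x.2

/-- The diagonal action `h (m ⊗ n) = h₍₁₎ m ⊗ h₍₂₎ n` of `H` on `M ⊗_t N`. -/
instance : SMul H (TensorT k H M N) where
  smul h x := ⟨act M N (Δ h) (incl k H M N x), act_comul_mem h _⟩

lemma incl_smul (h : H) (x : TensorT k H M N) :
    incl k H M N (h • x) = act M N (Δ h) (incl k H M N x) := rfl

instance : Module H (TensorT k H M N) where
  one_smul x := incl_ext (act_comul_one_incl x)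
  mul_smul g h x := incl_ext (by
    rw [incl_smul, incl_smul, incl_smul, comul_mul, map_mul, Module.End.mul_apply])
  smul_zero h := incl_ext (by rw [incl_smul, map_zero, map_zero])
  smul_add h x y := incl_ext (by
    rw [incl_smul, map_add, map_add, map_add, incl_smul, incl_smul])
  add_smul g h x := incl_ext (by
    rw [incl_smul, map_add, map_add, map_add, incl_smul, incl_smul, LinearMap.add_apply])
  zero_smul x := incl_ext (by
    rw [incl_smul, map_zero, map_zero, map_zero, LinearMap.zero_apply])

instance : IsScalarTower k H (TensorT k H M N) where
  smul_assoc c h x := incl_ext (by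
    rw [incl_smul, map_smul, map_smul, map_smul, incl_smul, LinearMap.smul_apply])

variable (k H M N) in
/-- The projection `M ⊗ N → M ⊗_t N`, `m ⊗ n ↦ 1₍₁₎ m ⊗ 1₍₂₎ n`. -/
def proj : M ⊗[k] N →ₗ[k] TensorT k H M N :=
  (act (k := k) (H := H) M N (Δ 1)).rangeRestrict

lemma incl_proj (x : M ⊗[k] N) : incl k H M N (proj k H M N x) = act M N (Δ 1) x := rfl

lemma proj_incl (x : TensorT k H M N) : proj k H M N (incl k H M N x) = x :=
  incl_ext (act_comul_one_incl x)

lemma proj_act_comul (h : H) (x : M ⊗[k] N) :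
    proj k H M N (act M N (Δ h) x) = h • proj k H M N x := by
  apply incl_ext
  rw [incl_proj, incl_smul, incl_proj, ← Module.End.mul_apply, ← Module.End.mul_apply,
    ← map_mul (act M N), ← map_mul (act M N), ← comul_mul, ← comul_mul, one_mul, mul_one]

/-- `k`-linear maps out of `M ⊗_t N` agree when they agree on all `1₍₁₎ m ⊗ 1₍₂₎ n`. -/
lemma tensorT_ext {Q : Type v} [AddCommMonoid Q] [Module k Q] {f g : TensorT k H M N →ₗ[k] Q}
    (h : ∀ m n, f (proj k H M N (m ⊗ₜ n)) = g (proj k H M N (m ⊗ₜ n))) : f = g := by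
  have : f ∘ₗ proj k H M N = g ∘ₗ proj k H M N := TensorProduct.ext' h
  ext1 x
  rw [← proj_incl x]
  exact LinearMap.congr_fun this (incl k H M N x)

lemma proj_induction {p : TensorT k H M N → Prop} (x : TensorT k H M N) (h0 : p 0)
    (h : ∀ m n, p (proj k H M N (m ⊗ₜ n))) (hadd : ∀ x y, p x → p y → p (x + y)) : p x := by
  rw [← proj_incl x]
  induction incl k H M N x using TensorProduct.induction_on with
  | zero => simpa using h0
  | tmul m n => exact h m n
  | add s t hs ht => rw [map_add]; exact hadd _ _ hs ht

/-- The tensor product `f ⊗_t g` of `H`-linear maps, the restriction of `f ⊗ g`. -/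
def mapT {M' N' : Type v} [AddCommGroup M'] [Module k M'] [Module H M'] [IsScalarTower k H M']
    [AddCommGroup N'] [Module k N'] [Module H N'] [IsScalarTower k H N']
    (f : M →ₗ[H] M') (g : N →ₗ[H] N') : TensorT k H M N →ₗ[H] TensorT k H M' N' :=
  have key : ∀ (s : H ⊗[k] H) (x : M ⊗[k] N),
      TensorProduct.map (f.restrictScalars k) (g.restrictScalars k) (act M N s x) =
        act M' N' s (TensorProduct.map (f.restrictScalars k) (g.restrictScalars k) x) := by
    intro s x
    induction s using TensorProduct.induction_on with
    | zero => simp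
    | add s t hs ht => simp only [map_add, LinearMap.add_apply, hs, ht]
    | tmul a b =>
      induction x using TensorProduct.induction_on with
      | zero => simp
      | add s t hs ht => simp only [map_add, hs, ht]
      | tmul m n => simp
  { toFun := fun x =>
      ⟨TensorProduct.map (f.restrictScalars k) (g.restrictScalars k) (incl k H M N x), by
        rw [← act_comul_one_incl x, key]; exact act_comul_mem 1 _⟩
    map_add' := fun x y => incl_ext (by
      change TensorProduct.map _ _ (incl k H M N (x + y)) =
        TensorProduct.map _ _ (incl k H M N x) + TensorProduct.map _ _ (incl k H M N y)
      rw [map_add, map_add])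
    map_smul' := fun h x => incl_ext (key (Δ h) (incl k H M N x)) }

lemma incl_mapT {M' N' : Type v} [AddCommGroup M'] [Module k M'] [Module H M']
    [IsScalarTower k H M'] [AddCommGroup N'] [Module k N'] [Module H N'] [IsScalarTower k H N']
    (f : M →ₗ[H] M') (g : N →ₗ[H] N') (x : TensorT k H M N) :
    incl k H M' N' (mapT f g x) =
      TensorProduct.map (f.restrictScalars k) (g.restrictScalars k) (incl k H M N x) := rfl

@[simp] lemma mapT_proj {M' N' : Type v} [AddCommGroup M'] [Module k M'] [Module H M']
    [IsScalarTower k H M'] [AddCommGroup N'] [Module k N'] [Module H N'] [IsScalarTower k H N']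
    (f : M →ₗ[H] M') (g : N →ₗ[H] N') (m : M) (n : N) :
    mapT f g (proj k H M N (m ⊗ₜ n)) = proj k H M' N' (f m ⊗ₜ g n) := by
  apply incl_ext
  rw [incl_mapT, incl_proj, incl_proj]
  induction Δ (1 : H) using TensorProduct.induction_on with
  | zero => simp
  | add s t hs ht => simp only [map_add, LinearMap.add_apply, hs, ht]
  | tmul a b => simp

/-! ### Associativity -/

lemma rTensor_coe_act (s : H ⊗[k] H) (x : TensorT k H M N ⊗[k] P) :
    LinearMap.rTensor P (incl k H M N) (act _ P s x) =
      tensorAct (act M N) (Algebra.lsmul k k P) (LinearMap.rTensor H Δ s)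
        (LinearMap.rTensor P (incl k H M N) x) := by
  induction s using TensorProduct.induction_on with
  | zero => simp
  | add s t hs ht => simp only [map_add, LinearMap.add_apply, hs, ht]
  | tmul a b =>
    induction x using TensorProduct.induction_on with
    | zero => simp
    | add s t hs ht => simp only [map_add, hs, ht]
    | tmul m n => simp [incl_smul]

lemma lTensor_coe_act (s : H ⊗[k] H) (x : M ⊗[k] TensorT k H N P) :
    LinearMap.lTensor M (incl k H N P) (act M _ s x) =
      tensorAct (Algebra.lsmul k k M) (act N P) (LinearMap.lTensor H Δ s)
        (LinearMap.lTensor M (incl k H N P) x) := by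
  induction s using TensorProduct.induction_on with
  | zero => simp
  | add s t hs ht => simp only [map_add, LinearMap.add_apply, hs, ht]
  | tmul a b =>
    induction x using TensorProduct.induction_on with
    | zero => simp
    | add s t hs ht => simp only [map_add, hs, ht]
    | tmul m n => simp [incl_smul]

lemma lTensor_proj_act (s : H ⊗[k] H) (x : M ⊗[k] (N ⊗[k] P)) :
    LinearMap.lTensor M (proj k H N P)
        (tensorAct (Algebra.lsmul k k M) (act N P) (LinearMap.lTensor H Δ s) x) =
      act M _ s (LinearMap.lTensor M (proj k H N P) x) := by
  induction s using TensorProduct.induction_on with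
  | zero => simp
  | add s t hs ht => simp only [map_add, LinearMap.add_apply, hs, ht]
  | tmul a b =>
    induction x using TensorProduct.induction_on with
    | zero => simp
    | add s t hs ht => simp only [map_add, hs, ht]
    | tmul m n => simp [proj_act_comul]

lemma rTensor_proj_act (s : H ⊗[k] H) (x : (M ⊗[k] N) ⊗[k] P) :
    LinearMap.rTensor P (proj k H M N)
        (tensorAct (act M N) (Algebra.lsmul k k P) (LinearMap.rTensor H Δ s) x) =
      act _ P s (LinearMap.rTensor P (proj k H M N) x) := by
  induction s using TensorProduct.induction_on with
  | zero => simp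
  | add s t hs ht => simp only [map_add, LinearMap.add_apply, hs, ht]
  | tmul a b =>
    induction x using TensorProduct.induction_on with
    | zero => simp
    | add s t hs ht => simp only [map_add, hs, ht]
    | tmul m n => simp [proj_act_comul]

lemma assoc_tensorAct (t : (H ⊗[k] H) ⊗[k] H) (x : (M ⊗[k] N) ⊗[k] P) :
    TensorProduct.assoc k M N P (tensorAct (act M N) (Algebra.lsmul k k P) t x) =
      tensorAct (Algebra.lsmul k k M) (act N P) (TensorProduct.assoc k H H H t)
        (TensorProduct.assoc k M N P x) := by
  induction t using TensorProduct.induction_on with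
  | zero => simp
  | add s t hs ht => simp only [map_add, LinearMap.add_apply, hs, ht]
  | tmul s c =>
    induction s using TensorProduct.induction_on with
    | zero => simp
    | add s t hs ht =>
      simp only [map_add, LinearMap.add_apply, hs, ht, TensorProduct.add_tmul]
    | tmul a b =>
      induction x using TensorProduct.induction_on with
      | zero => simp
      | add s t hs ht => simp only [map_add, hs, ht]
      | tmul y p =>
        induction y using TensorProduct.induction_on with
        | zero => simp
        | add s t hs ht => simp only [map_add, hs, ht, TensorProduct.add_tmul]
        | tmul m n => simp

lemma rTensor_comul_mul (s : H ⊗[k] H) :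
    LinearMap.rTensor H Δ s * (Δ 1 ⊗ₜ 1) = LinearMap.rTensor H Δ s := by
  induction s using TensorProduct.induction_on with
  | zero => simp
  | add s t hs ht => simp only [map_add, add_mul, hs, ht]
  | tmul a b => simp [← comul_mul]

lemma lTensor_comul_mul (s : H ⊗[k] H) :
    LinearMap.lTensor H Δ s * (1 ⊗ₜ Δ 1) = LinearMap.lTensor H Δ s := by
  induction s using TensorProduct.induction_on with
  | zero => simp
  | add s t hs ht => simp only [map_add, add_mul, hs, ht]
  | tmul a b => simp [← comul_mul]

variable (k H M N P) in
/-- The associativity constraint: the map induced by `(m ⊗ n) ⊗ p ↦ m ⊗ (n ⊗ p)`. -/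
def assocHom : TensorT k H (TensorT k H M N) P →ₗ[H] TensorT k H M (TensorT k H N P) where
  toFun x := proj k H M _ (LinearMap.lTensor M (proj k H N P) (TensorProduct.assoc k M N P
    (LinearMap.rTensor P (incl k H M N) (incl k H _ P x))))
  map_add' x y := by simp only [map_add]
  map_smul' h x := by
    rw [incl_smul, rTensor_coe_act, assoc_tensorAct, Coalgebra.coassoc_apply,
      lTensor_proj_act, proj_act_comul]; rfl

variable (k H M N P) in
/-- The inverse of the associativity constraint: the map induced by
`m ⊗ (n ⊗ p) ↦ (m ⊗ n) ⊗ p`. -/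
def assocInv : TensorT k H M (TensorT k H N P) →ₗ[H] TensorT k H (TensorT k H M N) P where
  toFun x := proj k H _ P (LinearMap.rTensor P (proj k H M N) ((TensorProduct.assoc k M N P).symm
    (LinearMap.lTensor M (incl k H N P) (incl k H M _ x))))
  map_add' x y := by simp only [map_add]
  map_smul' h x := by
    have : (TensorProduct.assoc k M N P).symm
        (tensorAct (Algebra.lsmul k k M) (act N P) (LinearMap.lTensor H Δ (Δ h))
          (LinearMap.lTensor M (incl k H N P) (incl k H M _ x))) =
        tensorAct (act M N) (Algebra.lsmul k k P) (LinearMap.rTensor H Δ (Δ h))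
          ((TensorProduct.assoc k M N P).symm
            (LinearMap.lTensor M (incl k H N P) (incl k H M _ x))) := by
      rw [LinearEquiv.symm_apply_eq, assoc_tensorAct, Coalgebra.coassoc_apply,
        LinearEquiv.apply_symm_apply]
    rw [incl_smul, lTensor_coe_act, this, rTensor_proj_act, proj_act_comul]; rfl

@[simp] lemma assocHom_proj (m : M) (n : N) (p : P) :
    assocHom k H M N P (proj k H _ P (proj k H M N (m ⊗ₜ n) ⊗ₜ p)) =
      proj k H M _ (m ⊗ₜ proj k H N P (n ⊗ₜ p)) := by
  change proj k H M _ (LinearMap.lTensor M (proj k H N P) (TensorProduct.assoc k M N P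
    (LinearMap.rTensor P (incl k H M N) (act _ P (Δ (1 : H)) _)))) = _
  have : LinearMap.rTensor P (incl k H M N) (proj k H M N (m ⊗ₜ n) ⊗ₜ[k] p) =
      tensorAct (act M N) (Algebra.lsmul k k P) (Δ 1 ⊗ₜ[k] (1 : H)) ((m ⊗ₜ n) ⊗ₜ p) := by
    simp [incl_proj]
  rw [rTensor_coe_act, this, ← Module.End.mul_apply, ← map_mul (tensorAct _ _), rTensor_comul_mul,
    assoc_tensorAct, Coalgebra.coassoc_apply, lTensor_proj_act, proj_act_comul, one_smul]
  simp

@[simp] lemma assocInv_proj (m : M) (n : N) (p : P) :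
    assocInv k H M N P (proj k H M _ (m ⊗ₜ proj k H N P (n ⊗ₜ p))) =
      proj k H _ P (proj k H M N (m ⊗ₜ n) ⊗ₜ p) := by
  change proj k H _ P (LinearMap.rTensor P (proj k H M N) ((TensorProduct.assoc k M N P).symm
    (LinearMap.lTensor M (incl k H N P) (act M _ (Δ (1 : H)) _)))) = _
  have h1 : LinearMap.lTensor M (incl k H N P) (m ⊗ₜ[k] proj k H N P (n ⊗ₜ p)) =
      tensorAct (Algebra.lsmul k k M) (act N P) ((1 : H) ⊗ₜ[k] Δ 1) (m ⊗ₜ (n ⊗ₜ p)) := by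
    simp [incl_proj]
  have h2 : (TensorProduct.assoc k M N P).symm
        (tensorAct (Algebra.lsmul k k M) (act N P) (LinearMap.lTensor H Δ (Δ 1))
          (m ⊗ₜ (n ⊗ₜ p))) =
        tensorAct (act M N) (Algebra.lsmul k k P) (LinearMap.rTensor H Δ (Δ 1))
          ((m ⊗ₜ n) ⊗ₜ p) := by
    rw [LinearEquiv.symm_apply_eq, assoc_tensorAct, Coalgebra.coassoc_apply,
      TensorProduct.assoc_tmul]
  rw [lTensor_coe_act, h1, ← Module.End.mul_apply, ← map_mul (tensorAct _ _), lTensor_comul_mul,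
    h2, rTensor_proj_act, proj_act_comul, one_smul]
  simp

/-- Linear maps out of `(M ⊗_t N) ⊗_t P` agree when they agree on generators. -/
lemma tensorT_ext₃ {Q : Type v} [AddCommMonoid Q] [Module k Q]
    {f g : TensorT k H (TensorT k H M N) P →ₗ[k] Q}
    (h : ∀ m n p, f (proj k H _ P (proj k H M N (m ⊗ₜ n) ⊗ₜ p)) =
      g (proj k H _ P (proj k H M N (m ⊗ₜ n) ⊗ₜ p))) : f = g := by
  apply tensorT_ext
  intro x p
  induction x using proj_induction with
  | h0 => simp
  | h m n => exact h m n p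
  | hadd x y hx hy => simp only [TensorProduct.add_tmul, map_add, hx, hy]

/-- Linear maps out of `M ⊗_t (N ⊗_t P)` agree when they agree on generators. -/
lemma tensorT_ext₃' {Q : Type v} [AddCommMonoid Q] [Module k Q]
    {f g : TensorT k H M (TensorT k H N P) →ₗ[k] Q}
    (h : ∀ m n p, f (proj k H M _ (m ⊗ₜ proj k H N P (n ⊗ₜ p))) =
      g (proj k H M _ (m ⊗ₜ proj k H N P (n ⊗ₜ p)))) : f = g := by
  apply tensorT_ext
  intro m x
  induction x using proj_induction with
  | h0 => simp
  | h n p => exact h m n p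
  | hadd x y hx hy => simp only [TensorProduct.tmul_add, map_add, hx, hy]

lemma tensorT_hext {Q : Type v} [AddCommGroup Q] [Module k Q] [Module H Q] [IsScalarTower k H Q]
    {f g : TensorT k H M N →ₗ[H] Q}
    (h : ∀ m n, f (proj k H M N (m ⊗ₜ n)) = g (proj k H M N (m ⊗ₜ n))) : f = g :=
  LinearMap.restrictScalars_injective k (tensorT_ext (f := f.restrictScalars k)
    (g := g.restrictScalars k) h)

lemma tensorT_hext₃ {Q : Type v} [AddCommGroup Q] [Module k Q] [Module H Q] [IsScalarTower k H Q]
    {f g : TensorT k H (TensorT k H M N) P →ₗ[H] Q}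
    (h : ∀ m n p, f (proj k H _ P (proj k H M N (m ⊗ₜ n) ⊗ₜ p)) =
      g (proj k H _ P (proj k H M N (m ⊗ₜ n) ⊗ₜ p))) : f = g :=
  LinearMap.restrictScalars_injective k (tensorT_ext₃ (f := f.restrictScalars k)
    (g := g.restrictScalars k) h)

lemma tensorT_hext₃' {Q : Type v} [AddCommGroup Q] [Module k Q] [Module H Q] [IsScalarTower k H Q]
    {f g : TensorT k H M (TensorT k H N P) →ₗ[H] Q}
    (h : ∀ m n p, f (proj k H M _ (m ⊗ₜ proj k H N P (n ⊗ₜ p))) =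
      g (proj k H M _ (m ⊗ₜ proj k H N P (n ⊗ₜ p)))) : f = g :=
  LinearMap.restrictScalars_injective k (tensorT_ext₃' (f := f.restrictScalars k)
    (g := g.restrictScalars k) h)

variable (k H M N P) in
/-- The associativity constraint `(M ⊗_t N) ⊗_t P ≃ M ⊗_t (N ⊗_t P)`. -/
def assocEquiv : TensorT k H (TensorT k H M N) P ≃ₗ[H] TensorT k H M (TensorT k H N P) :=
  LinearEquiv.ofLinearMap (assocHom k H M N P) (assocInv k H M N P)
    (tensorT_hext₃' fun m n p => by simp)
    (tensorT_hext₃ fun m n p => by simp)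

@[simp] lemma assocEquiv_proj (m : M) (n : N) (p : P) :
    assocEquiv k H M N P (proj k H _ P (proj k H M N (m ⊗ₜ n) ⊗ₜ p)) =
      proj k H M _ (m ⊗ₜ proj k H N P (n ⊗ₜ p)) := assocHom_proj m n p

/-! ### The unit object -/

variable (k H) in
/-- The target space `H_t`, the image of the target map. -/
def targetSpace : Submodule k H := LinearMap.range (targetMap k H)

variable (k H) in
/-- The target space `H_t`, as a type. -/
def TargetSpace : Type v := ↥(targetSpace k H)

instance : AddCommGroup (TargetSpace k H) := inferInstanceAs (AddCommGroup ↥(targetSpace k H))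

instance : Module k (TargetSpace k H) := inferInstanceAs (Module k ↥(targetSpace k H))

variable (k H) in
/-- The inclusion `H_t → H`. -/
def targetIncl : TargetSpace k H →ₗ[k] H := (targetSpace k H).subtype

lemma targetIncl_ext {x y : TargetSpace k H} (h : targetIncl k H x = targetIncl k H y) : x = y :=
  Subtype.ext h

lemma targetMap_incl (z : TargetSpace k H) :
    targetMap k H (targetIncl k H z) = targetIncl k H z := by
  obtain ⟨z, ⟨g, rfl⟩⟩ := z
  exact targetMap_targetMap g

/-- The left `H`-action `h ⇀ z = ε_t(h z)` on `H_t`. -/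
instance : SMul H (TargetSpace k H) where
  smul h z := ⟨targetMap k H (h * targetIncl k H z), ⟨_, rfl⟩⟩

lemma targetIncl_smul (h : H) (z : TargetSpace k H) :
    targetIncl k H (h • z) = targetMap k H (h * targetIncl k H z) := rfl

instance : Module H (TargetSpace k H) where
  one_smul z := targetIncl_ext (by rw [targetIncl_smul, one_mul, targetMap_incl])
  mul_smul g h z := targetIncl_ext (by
    rw [targetIncl_smul, targetIncl_smul, targetIncl_smul, targetMap_mul_targetMap, mul_assoc])
  smul_zero h := targetIncl_ext (by rw [targetIncl_smul, map_zero, mul_zero, map_zero])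
  smul_add h x y := targetIncl_ext (by
    rw [targetIncl_smul, map_add, map_add, mul_add, map_add, targetIncl_smul, targetIncl_smul])
  add_smul g h x := targetIncl_ext (by
    rw [targetIncl_smul, map_add, add_mul, map_add, targetIncl_smul, targetIncl_smul])
  zero_smul x := targetIncl_ext (by rw [targetIncl_smul, zero_mul, map_zero, map_zero])

instance : IsScalarTower k H (TargetSpace k H) where
  smul_assoc c h z := targetIncl_ext (by
    rw [targetIncl_smul, map_smul, targetIncl_smul, smul_mul_assoc, map_smul])

variable (k H) in
/-- The unit element as an element of `H_t`. -/
def targetOne : TargetSpace k H := ⟨1, ⟨1, targetMap_one⟩⟩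

lemma targetIncl_one : targetIncl k H (targetOne k H) = 1 := rfl

lemma proj_tmul_targetSpace_smul (m : M) (n : N) (z : TargetSpace k H) :
    proj k H M N (m ⊗ₜ (targetIncl k H z • n)) = proj k H M N ((sourceMapOp k H (targetIncl k H z) • m) ⊗ₜ n) := by
  apply incl_ext
  have h1 : (m ⊗ₜ[k] (targetIncl k H z • n)) = act M N (1 ⊗ₜ targetIncl k H z) (m ⊗ₜ n) := by simp
  have h2 : ((sourceMapOp k H (targetIncl k H z) • m) ⊗ₜ[k] n) =
    act M N (sourceMapOp k H (targetIncl k H z) ⊗ₜ 1) (m ⊗ₜ n) := by simp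
  rw [incl_proj, incl_proj, h1, h2, ← Module.End.mul_apply, ← Module.End.mul_apply,
    ← map_mul (act M N), ← map_mul (act M N), ← comul_one_mul_targetMap, targetMap_incl]

lemma lift_aux (h : H) (z : TargetSpace k H) (m : M) :
    TensorProduct.lift ((Algebra.lsmul k k M).toLinearMap ∘ₗ targetIncl k H)
      (act _ M (Δ h) (z ⊗ₜ m)) = h • targetIncl k H z • m := by
  have h1 : ∀ s : H ⊗[k] H,
      TensorProduct.lift ((Algebra.lsmul k k M).toLinearMap ∘ₗ targetIncl k H)
        (act _ M s (z ⊗ₜ m)) = evL k (targetIncl k H z) (Δ 1 * s) • m := by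
    intro s
    induction s using TensorProduct.induction_on with
    | zero => simp
    | add s t hs ht => simp only [map_add, LinearMap.add_apply, hs, ht, mul_add, add_smul]
    | tmul a b =>
      have : ∀ t : H ⊗[k] H, evL k (a * targetIncl k H z) t * b = evL k (targetIncl k H z) (t * (a ⊗ₜ b)) := by
        intro t
        induction t using TensorProduct.induction_on with
        | zero => simp
        | add s t hs ht => simp only [map_add, add_mul, hs, ht]
        | tmul c d => simp [mul_assoc]
      rw [← this]
      simp [targetIncl_smul, smul_smul, targetMap_apply]
  rw [h1, comul_one_mul, evL_comul, targetMap_incl, mul_smul]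

lemma lift_aux' (h : H) (z : TargetSpace k H) (m : M) :
    TensorProduct.lift (((Algebra.lsmul k k M).toLinearMap ∘ₗ sourceMapOp k H ∘ₗ
      targetIncl k H).flip)
      (act M _ (Δ h) (m ⊗ₜ z)) = h • sourceMapOp k H (targetIncl k H z) • m := by
  have h1 : ∀ s : H ⊗[k] H,
      TensorProduct.lift (((Algebra.lsmul k k M).toLinearMap ∘ₗ sourceMapOp k H ∘ₗ
      targetIncl k H).flip)
        (act M _ s (m ⊗ₜ z)) = evR k (targetIncl k H z) (Δ 1 * s) • m := by
    intro s
    induction s using TensorProduct.induction_on with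
    | zero => simp
    | add s t hs ht => simp only [map_add, LinearMap.add_apply, hs, ht, mul_add, add_smul]
    | tmul a b =>
      have : ∀ t : H ⊗[k] H, evR k (b * targetIncl k H z) t * a = evR k (targetIncl k H z) (t * (a ⊗ₜ b)) := by
        intro t
        induction t using TensorProduct.induction_on with
        | zero => simp
        | add s t hs ht => simp only [map_add, add_mul, hs, ht]
        | tmul c d => simp [mul_assoc]
      rw [← this]
      rw [act_tmul, TensorProduct.lift.tmul]
      simp [targetIncl_smul, smul_smul, sourceMapOp_targetMap, ← sourceMapOp_apply]
  rw [h1, comul_one_mul, evR_comul, mul_smul]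

variable (k H M) in
/-- The left unit constraint `1₍₁₎ ⇀ z ⊗ 1₍₂₎ m ↦ z m`, the restriction of `z ⊗ m ↦ z m`. -/
def leftUnitHom : TensorT k H (TargetSpace k H) M →ₗ[H] M where
  toFun x := TensorProduct.lift
    ((Algebra.lsmul k k M).toLinearMap ∘ₗ targetIncl k H) (incl k H _ M x)
  map_add' x y := by simp only [map_add]
  map_smul' h x := by
    rw [incl_smul]
    induction incl k H _ M x using TensorProduct.induction_on with
    | zero => simp
    | add s t hs ht => simp only [map_add, hs, ht, smul_add]
    | tmul z m => rw [lift_aux]; simp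

@[simp] lemma leftUnitHom_proj (z : TargetSpace k H) (m : M) :
    leftUnitHom k H M (proj k H _ M (z ⊗ₜ m)) = targetIncl k H z • m :=
  (lift_aux 1 z m).trans (one_smul _ _)

variable (k H M) in
/-- The right unit constraint `1₍₁₎ m ⊗ 1₍₂₎ ⇀ z ↦ ε̄_s(z) m`, the restriction of
`m ⊗ z ↦ ε̄_s(z) m`. -/
def rightUnitHom : TensorT k H M (TargetSpace k H) →ₗ[H] M where
  toFun x := TensorProduct.lift (((Algebra.lsmul k k M).toLinearMap ∘ₗ sourceMapOp k H ∘ₗ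
      targetIncl k H).flip) (incl k H M _ x)
  map_add' x y := by simp only [map_add]
  map_smul' h x := by
    rw [incl_smul]
    induction incl k H M _ x using TensorProduct.induction_on with
    | zero => simp
    | add s t hs ht => simp only [map_add, hs, ht, smul_add]
    | tmul m z => rw [lift_aux']; simp

@[simp] lemma rightUnitHom_proj (m : M) (z : TargetSpace k H) :
    rightUnitHom k H M (proj k H M _ (m ⊗ₜ z)) = sourceMapOp k H (targetIncl k H z) • m :=
  (lift_aux' 1 z m).trans (one_smul _ _)

variable (k H M) in
/-- The left unit constraint `H_t ⊗_t M ≃ M`, with inverse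
`m ↦ 1₍₁₎ ⇀ 1 ⊗ 1₍₂₎ m = ε_t(1₍₁₎) ⊗ 1₍₂₎ m`. -/
def leftUnitEquiv : TensorT k H (TargetSpace k H) M ≃ₗ[H] M :=
  { leftUnitHom k H M with
    invFun := fun m => proj k H _ M (targetOne k H ⊗ₜ m)
    left_inv := by
      have : (proj k H _ M ∘ₗ TensorProduct.mk k _ M (targetOne k H)) ∘ₗ
          (leftUnitHom k H M).restrictScalars k = LinearMap.id := by
        refine tensorT_ext (k := k) (H := H) (M := TargetSpace k H) (N := M) ?_
        intro z m
        have h : sourceMapOp k H (targetIncl k H z) • targetOne k H = z := targetIncl_ext (by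
          rw [targetIncl_smul]
          simp [targetIncl_one, targetMap_sourceMapOp, targetMap_incl])
        simp [proj_tmul_targetSpace_smul, h]
      exact fun x => LinearMap.congr_fun this x
    right_inv := fun m => (leftUnitHom_proj _ m).trans (one_smul H m) }

variable (k H M) in
/-- The right unit constraint `M ⊗_t H_t ≃ M`, with inverse
`m ↦ 1₍₁₎ m ⊗ 1₍₂₎ ⇀ 1 = 1₍₁₎ m ⊗ 1₍₂₎`. -/
def rightUnitEquiv : TensorT k H M (TargetSpace k H) ≃ₗ[H] M :=
  { rightUnitHom k H M with
    invFun := fun m => proj k H M _ (m ⊗ₜ targetOne k H)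
    left_inv := by
      have : (proj k H M _ ∘ₗ (TensorProduct.mk k M _).flip (targetOne k H)) ∘ₗ
          (rightUnitHom k H M).restrictScalars k = LinearMap.id := by
        apply tensorT_ext
        intro m z
        have h : targetIncl k H z • targetOne k H = z := targetIncl_ext (by
          rw [targetIncl_smul]
          simp [targetIncl_one, targetMap_incl])
        simp [← proj_tmul_targetSpace_smul, h]
      exact fun x => LinearMap.congr_fun this x
    right_inv := fun m => (rightUnitHom_proj m _).trans (by
      change sourceMapOp k H 1 • m = m
      rw [sourceMapOp_one, one_smul]) }

@[simp] lemma leftUnitEquiv_proj (z : TargetSpace k H) (m : M) :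
    leftUnitEquiv k H M (proj k H _ M (z ⊗ₜ m)) = targetIncl k H z • m := leftUnitHom_proj z m

@[simp] lemma rightUnitEquiv_proj (m : M) (z : TargetSpace k H) :
    rightUnitEquiv k H M (proj k H M _ (m ⊗ₜ z)) = sourceMapOp k H (targetIncl k H z) • m := rightUnitHom_proj m z

/-! ### Coherence -/

section Coherence

variable {M' N' P' : Type v}
  [AddCommGroup M'] [Module k M'] [Module H M'] [IsScalarTower k H M']
  [AddCommGroup N'] [Module k N'] [Module H N'] [IsScalarTower k H N']
  [AddCommGroup P'] [Module k P'] [Module H P'] [IsScalarTower k H P']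

lemma mapT_id : mapT (k := k) (LinearMap.id : M →ₗ[H] M) (LinearMap.id : N →ₗ[H] N) =
    LinearMap.id :=
  tensorT_hext fun m n => by rw [mapT_proj]; rfl

lemma mapT_comp {M'' N'' : Type v}
    [AddCommGroup M''] [Module k M''] [Module H M''] [IsScalarTower k H M'']
    [AddCommGroup N''] [Module k N''] [Module H N''] [IsScalarTower k H N'']
    (f : M →ₗ[H] M') (f' : M' →ₗ[H] M'') (g : N →ₗ[H] N') (g' : N' →ₗ[H] N'') :
    mapT (k := k) f' g' ∘ₗ mapT f g = mapT (f' ∘ₗ f) (g' ∘ₗ g) :=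
  tensorT_hext fun m n => by
    rw [LinearMap.comp_apply, mapT_proj, mapT_proj, mapT_proj]; rfl

lemma assoc_naturality (f : M →ₗ[H] M') (g : N →ₗ[H] N') (h : P →ₗ[H] P') :
    (assocEquiv k H M' N' P').toLinearMap ∘ₗ mapT (mapT f g) h =
      mapT f (mapT g h) ∘ₗ (assocEquiv k H M N P).toLinearMap :=
  tensorT_hext₃ fun m n p => by
    rw [LinearMap.comp_apply, LinearMap.comp_apply, LinearEquiv.coe_coe, LinearEquiv.coe_coe,
      mapT_proj, mapT_proj, assocEquiv_proj, assocEquiv_proj, mapT_proj, mapT_proj]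

lemma leftUnit_naturality (f : M →ₗ[H] M') :
    (leftUnitEquiv k H M').toLinearMap ∘ₗ mapT LinearMap.id f =
      f ∘ₗ (leftUnitEquiv k H M).toLinearMap :=
  tensorT_hext fun z m => by
    rw [LinearMap.comp_apply, LinearMap.comp_apply, LinearEquiv.coe_coe, LinearEquiv.coe_coe,
      mapT_proj, leftUnitEquiv_proj, leftUnitEquiv_proj, map_smul]; rfl

lemma rightUnit_naturality (f : M →ₗ[H] M') :
    (rightUnitEquiv k H M').toLinearMap ∘ₗ mapT f LinearMap.id =
      f ∘ₗ (rightUnitEquiv k H M).toLinearMap :=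
  tensorT_hext fun m z => by
    rw [LinearMap.comp_apply, LinearMap.comp_apply, LinearEquiv.coe_coe, LinearEquiv.coe_coe,
      mapT_proj, rightUnitEquiv_proj, rightUnitEquiv_proj, map_smul]; rfl

lemma assoc_pentagon {W X Y Z : Type v}
    [AddCommGroup W] [Module k W] [Module H W] [IsScalarTower k H W]
    [AddCommGroup X] [Module k X] [Module H X] [IsScalarTower k H X]
    [AddCommGroup Y] [Module k Y] [Module H Y] [IsScalarTower k H Y]
    [AddCommGroup Z] [Module k Z] [Module H Z] [IsScalarTower k H Z] :
    (mapT LinearMap.id (assocEquiv k H X Y Z).toLinearMap ∘ₗ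
        (assocEquiv k H W (TensorT k H X Y) Z).toLinearMap) ∘ₗ
          mapT (assocEquiv k H W X Y).toLinearMap LinearMap.id =
      (assocEquiv k H W X (TensorT k H Y Z)).toLinearMap ∘ₗ
        (assocEquiv k H (TensorT k H W X) Y Z).toLinearMap :=
  tensorT_hext₃ fun s y z => by
    induction s using proj_induction with
    | h0 => simp only [TensorProduct.zero_tmul, map_zero]
    | hadd x x' hx hx' => simp only [TensorProduct.add_tmul, map_add, hx, hx']
    | h w x =>
      simp only [LinearMap.comp_apply, LinearEquiv.coe_coe, mapT_proj, assocEquiv_proj,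
        LinearMap.id_apply]

lemma unit_triangle :
    mapT LinearMap.id (leftUnitEquiv k H N).toLinearMap ∘ₗ
        (assocEquiv k H M (TargetSpace k H) N).toLinearMap =
      mapT (rightUnitEquiv k H M).toLinearMap LinearMap.id :=
  tensorT_hext₃ fun m z n => by
    simp only [LinearMap.comp_apply, LinearEquiv.coe_coe, mapT_proj, assocEquiv_proj,
      LinearMap.id_apply, leftUnitEquiv_proj, rightUnitEquiv_proj, proj_tmul_targetSpace_smul]

end Coherence

end

end Tensor

/-! ## The monoidal category of left modules -/

section Monoidal

variable {k : Type u} {H : Type v} [CommRing k] [Ring H] [Algebra k H] [Coalgebra k H]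
  [IsWeakBialgebra k H]

instance : MonoidalCategoryStruct (LMod k H) where
  tensorObj M N := ⟨TensorT k H M N⟩
  whiskerLeft _ _ _ f := ⟨mapT LinearMap.id f.hom⟩
  whiskerRight f _ := ⟨mapT f.hom LinearMap.id⟩
  tensorHom f g := ⟨mapT f.hom g.hom⟩
  tensorUnit := ⟨TargetSpace k H⟩
  associator M N P := LMod.isoOfEquiv (assocEquiv k H M N P)
  leftUnitor M := LMod.isoOfEquiv (leftUnitEquiv k H M)
  rightUnitor M := LMod.isoOfEquiv (rightUnitEquiv k H M)

/-- The monoidal category of left `H`-modules, with tensor product `⊗_t` and unit object `H_t`. -/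
instance : MonoidalCategory (LMod k H) where
  tensorHom_def f g := LMod.hom_ext (mapT_comp f.hom LinearMap.id LinearMap.id g.hom).symm
  id_tensorHom_id _ _ := LMod.hom_ext mapT_id
  tensorHom_comp_tensorHom f₁ f₂ g₁ g₂ := LMod.hom_ext (mapT_comp f₁.hom g₁.hom f₂.hom g₂.hom)
  whiskerLeft_id _ _ := LMod.hom_ext mapT_id
  id_whiskerRight _ _ := LMod.hom_ext mapT_id
  associator_naturality f₁ f₂ f₃ := LMod.hom_ext (assoc_naturality f₁.hom f₂.hom f₃.hom)
  leftUnitor_naturality f := LMod.hom_ext (leftUnit_naturality f.hom)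
  rightUnitor_naturality f := LMod.hom_ext (rightUnit_naturality f.hom)
  pentagon _ _ _ _ := LMod.hom_ext assoc_pentagon
  triangle _ _ := LMod.hom_ext unit_triangle

end Monoidal

/-! ## The weak left center and the left center of a monoidal category -/

section Center

universe v₁ u₁

variable (C : Type u₁) [Category.{v₁} C] [MonoidalCategory C]

/-- Objects of the weak left center of `C`: an object `M` with a natural transformation
`σ_X : M ⊗ X ⟶ X ⊗ M`, not necessarily invertible, compatible with tensor products and such
that `σ_I` is the canonical isomorphism `M ⊗ I ≅ M ≅ I ⊗ M`. -/
structure WeakLeftCenter where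
  /-- the underlying object -/
  obj : C
  /-- the components of the natural transformation -/
  σ : ∀ X : C, obj ⊗ X ⟶ X ⊗ obj
  naturality : ∀ {X Y : C} (f : X ⟶ Y), obj ◁ f ≫ σ Y = σ X ≫ f ▷ obj
  tensor : ∀ X Y : C,
    σ X ▷ Y ≫ (α_ X obj Y).hom ≫ X ◁ σ Y =
      (α_ obj X Y).hom ≫ σ (X ⊗ Y) ≫ (α_ X Y obj).hom
  unit : σ (𝟙_ C) = (ρ_ obj).hom ≫ (λ_ obj).inv

namespace WeakLeftCenter

variable {C}

/-- Morphisms of the weak left center. -/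
@[ext]
structure Hom (A B : WeakLeftCenter C) where
  /-- the underlying morphism -/
  hom : A.obj ⟶ B.obj
  comm : ∀ X : C, A.σ X ≫ X ◁ hom = hom ▷ X ≫ B.σ X

instance : Category (WeakLeftCenter C) where
  Hom A B := Hom A B
  id A := ⟨𝟙 A.obj, by simp⟩
  comp f g := ⟨f.hom ≫ g.hom, fun X => by
    rw [MonoidalCategory.whiskerLeft_comp, ← Category.assoc, f.comm, Category.assoc, g.comm,
      comp_whiskerRight, Category.assoc]⟩

end WeakLeftCenter

/-- The left center of `C`: the full subcategory of the weak left center on the objects whose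
natural transformation is an isomorphism. -/
abbrev LeftCenter : Type _ :=
  ObjectProperty.FullSubcategory (fun A : WeakLeftCenter C => ∀ X : C, IsIso (A.σ X))

end Center

/-! ## Yetter-Drinfeld modules -/

section YetterDrinfeld

variable (k : Type u) (H : Type v) [CommRing k] [Ring H] [Algebra k H] [Coalgebra k H]

variable {k H} in
/-- For a `k`-linear map `λ : M → H ⊗ M` and `m ∈ M`, the map
`a ⊗ b ↦ (a m)₍₋₁₎ b ⊗ (a m)₍₀₎`. -/
def twist {M : LMod k H} (lam : M →ₗ[k] H ⊗[k] M) (m : M) : H ⊗[k] H →ₗ[k] H ⊗[k] M :=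
  TensorProduct.lift (LinearMap.mk₂ k
    (fun a b => LinearMap.rTensor M (LinearMap.mulRight k b) (lam (a • m)))
    (fun a a' b => by simp only [add_smul, map_add])
    (fun c a b => by simp only [smul_assoc, map_smul])
    (fun a b b' => by
      rw [← LinearMap.add_apply, ← LinearMap.rTensor_add]
      congr 2; ext x; simp [mul_add])
    (fun c a b => by
      rw [← LinearMap.smul_apply, ← LinearMap.rTensor_smul]
      congr 2; ext x; simp))

/-- A left-left Yetter-Drinfeld module over `H`: a left `H`-module `M` with a coassociative and
counital left `H`-coaction `coact(m) = m₍₋₁₎ ⊗ m₍₀₎` that takes its values in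
`H ⊗_t M = Δ(1)(H ⊗ M)` and satisfies
`h₍₁₎ m₍₋₁₎ ⊗ h₍₂₎ m₍₀₎ = (h₍₁₎ m)₍₋₁₎ h₍₂₎ ⊗ (h₍₁₎ m)₍₀₎`. -/
structure YetterDrinfeld where
  /-- the underlying left `H`-module -/
  obj : LMod k H
  /-- the left coaction -/
  coact : obj →ₗ[k] H ⊗[k] obj
  coassoc : ∀ m : obj,
    TensorProduct.assoc k H H obj (LinearMap.rTensor obj (Coalgebra.comul (R := k)) (coact m)) =
      LinearMap.lTensor H coact (coact m)
  counit : ∀ m : obj,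
    TensorProduct.lid k obj (LinearMap.rTensor obj (Coalgebra.counit (R := k)) (coact m)) = m
  mem : ∀ m : obj, coact m ∈ tensorT k H H obj
  compat : ∀ (h : H) (m : obj),
    act H obj (Coalgebra.comul (R := k) h) (coact m) =
      twist coact m (Coalgebra.comul (R := k) h)

namespace YetterDrinfeld

variable {k H}

/-- Morphisms of Yetter-Drinfeld modules: left `H`-linear, left `H`-colinear maps. -/
@[ext]
structure Hom (M N : YetterDrinfeld k H) where
  /-- the underlying `H`-linear map -/
  hom : M.obj →ₗ[H] N.obj
  colinear : ∀ m : M.obj,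
    N.coact (hom m) = LinearMap.lTensor H (hom.restrictScalars k) (M.coact m)

instance : Category (YetterDrinfeld k H) where
  Hom M N := Hom M N
  id M := ⟨LinearMap.id, fun m => by
    exact (LinearMap.congr_fun (LinearMap.lTensor_id H M.obj) (M.coact m)).symm⟩
  comp {M N P} f g := ⟨g.hom ∘ₗ f.hom, fun m => by
    rw [LinearMap.comp_apply, g.colinear, f.colinear, ← LinearMap.comp_apply,
      ← LinearMap.lTensor_comp]; rfl⟩

end YetterDrinfeld

end YetterDrinfeld

end

end WeakBialg

/-! A natural family `σ` is determined by its component at the regular module. For `x ∈ X` the map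
`h ↦ h x` from `H` to `X` is `H`-linear, so naturality forces `σ_X` to send the class of `m ⊗ x` to
`m₍₋₁₎ x ⊗ m₍₀₎`, where `λ(m) = σ_H(1₍₁₎ m ⊗ 1₍₂₎)` (`incl_braid_proj`). The center axioms then
become the Yetter-Drinfeld axioms for `λ`: the codomain of `σ_H` gives `λ(m) ∈ H ⊗_t M`,
`H`-linearity gives the compatibility, the tensor axiom at `X = Y = H` gives coassociativity, and
the unit axiom gives counitality. Conversely, `m ⊗ x ↦ m₍₋₁₎ x ⊗ m₍₀₎` defines a half-braiding
(`halfBraid`); the unit axiom is the least formal point and rests on `ε_t(m₍₋₁₎ g) m₍₀₎ = ε̄_s(g) m`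
(`targetMap_coact_mul`). The two passages are strictly inverse on objects. Colinearity of a linear
map is likewise detected at `X = H`, so the functor is fully faithful.

For the second claim let `T` be the inverse of `S`. The candidate inverse of the half-braiding is `x
⊗ m ↦ m₍₀₎ ⊗ T(m₍₋₁₎) x`. On the full tensor products the two composites are only `m₍₀₎ ⊗
T(ε_s(m₍₋₁₎)) x` and `ε̄_s(m₍₋₁₎) x ⊗ m₍₀₎`; they become identities after projection to `⊗_t`, where
`ε̄_s(h)` on the left factor may be traded for `ε_t(h)` on the right one. Computing these composites
needs antimultiplicativity of `S` (`IsAntipode.map_mul`), which is proved by a uniqueness argument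
in a convolution algebra. Hence every object of the weak center already lies in the center. -/

namespace WeakBialg

noncomputable section

/-! ### Counital maps and the antipode of a weak Hopf algebra -/

section Antipode

variable {k : Type u} {H : Type v} [CommRing k] [Ring H] [Algebra k H] [Coalgebra k H]

local notation "Δ" => Coalgebra.comul (R := k) (A := H)
local notation "ε" => Coalgebra.counit (R := k) (A := H)

variable (k) in
/-- `p ⊗ q ↦ ε(g q) p`. -/
def evRLeft (g : H) : H ⊗[k] H →ₗ[k] H :=
  (TensorProduct.rid k H).toLinearMap ∘ₗ
    LinearMap.lTensor H (Coalgebra.counit (R := k) ∘ₗ LinearMap.mulLeft k g)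

@[simp] lemma evRLeft_tmul (g p q : H) : evRLeft k g (p ⊗ₜ[k] q) = ε (g * q) • p := by
  simp [evRLeft]

lemma sourceMap_apply (g : H) : sourceMap k H g = evRLeft k g (Δ 1) := rfl

lemma evRLeft_congr {g g' : H} (h : ∀ x : H, ε (g * x) = ε (g' * x)) (s : H ⊗[k] H) :
    evRLeft k g s = evRLeft k g' s := by
  induction s using TensorProduct.induction_on with
  | zero => simp
  | add r r' hr hr' => simp only [map_add, hr, hr']
  | tmul c d => simp [h]

lemma sourceMap_one : sourceMap k H (1 : H) = 1 := by
  simp [sourceMap_apply, evRLeft]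

lemma conv_apply_repr {ι : Type*} {a : H} (r : Coalgebra.Repr k a ι) (f g : H →ₗ[k] H) :
    conv k f g a = ∑ i ∈ r.index, f (r.left i) * g (r.right i) := by
  simp [conv, ← r.eq]

/-- True by definition; it makes the associative product on `WithConv` available for `conv`. -/
lemma conv_eq_convMul (f g : H →ₗ[k] H) :
    conv k f g = (WithConv.toConv f * WithConv.toConv g).ofConv := rfl

lemma conv_assoc (f g h : H →ₗ[k] H) : conv k (conv k f g) h = conv k f (conv k g h) := by
  simp only [conv_eq_convMul, WithConv.toConv_ofConv, mul_assoc]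

lemma convMul_apply_tmul {a b : H} {ι κ : Type*} (r : Coalgebra.Repr k a ι)
    (s : Coalgebra.Repr k b κ) (f g : WithConv (H ⊗[k] H →ₗ[k] H)) :
    (f * g).ofConv (a ⊗ₜ b) = ∑ i ∈ r.index, ∑ j ∈ s.index,
      f.ofConv (r.left i ⊗ₜ s.left j) * g.ofConv (r.right i ⊗ₜ s.right j) := by
  change LinearMap.mul' k H (TensorProduct.map f.ofConv g.ofConv (Coalgebra.comul (a ⊗ₜ[k] b))) = _
  rw [TensorProduct.comul_tmul, ← r.eq, ← s.eq]
  simp [TensorProduct.sum_tmul, TensorProduct.tmul_sum]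
  exact Finset.sum_comm

variable [IsWeakBialgebra k H]

/-- Apply `ε(· g)` to the first leg of `Δ²(1) = (1 ⊗ Δ(1))(Δ(1) ⊗ 1)`. -/
lemma comul_targetMap (g : H) : Δ (targetMap k H g) = Δ 1 * (targetMap k H g ⊗ₜ 1) := by
  let Φ : H ⊗[k] (H ⊗[k] H) →ₗ[k] H ⊗[k] H :=
    (TensorProduct.lid k (H ⊗[k] H)).toLinearMap ∘ₗ
      LinearMap.rTensor (H ⊗[k] H) (ε ∘ₗ LinearMap.mulRight k g)
  have h1 : ∀ s : H ⊗[k] H, Δ (evL k g s) = Φ (LinearMap.lTensor H Δ s) := by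
    intro s
    induction s using TensorProduct.induction_on with
    | zero => simp
    | add s t hs ht => simp only [map_add, hs, ht]
    | tmul a b => simp [Φ]
  have h2 : ∀ s t : H ⊗[k] H,
      Φ ((1 ⊗ₜ t) * TensorProduct.assoc k H H H (s ⊗ₜ 1)) = t * (evL k g s ⊗ₜ 1) := by
    intro s t
    induction s using TensorProduct.induction_on with
    | zero => simp
    | add s s' hs hs' => simp only [TensorProduct.add_tmul, map_add, mul_add, hs, hs']
    | tmul a b => simp [Φ, ← TensorProduct.smul_tmul']
  rw [targetMap_apply, h1, IsWeakBialgebra.comul_comul_one', h2]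

/-- Apply `ε(g ·)` to the third leg of the same factorization of `Δ²(1)`, after rebracketing by
coassociativity. -/
lemma comul_sourceMap (g : H) : Δ (sourceMap k H g) = (1 ⊗ₜ sourceMap k H g) * Δ 1 := by
  let Φ : (H ⊗[k] H) ⊗[k] H →ₗ[k] H ⊗[k] H :=
    (TensorProduct.rid k (H ⊗[k] H)).toLinearMap ∘ₗ
      LinearMap.lTensor (H ⊗[k] H) (ε ∘ₗ LinearMap.mulLeft k g)
  have h1 : ∀ s : H ⊗[k] H, Δ (evRLeft k g s) = Φ (LinearMap.rTensor H Δ s) := by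
    intro s
    induction s using TensorProduct.induction_on with
    | zero => simp
    | add s t hs ht => simp only [map_add, hs, ht]
    | tmul a b => simp [Φ]
  have h2 : ∀ s t : H ⊗[k] H,
      Φ ((TensorProduct.assoc k H H H).symm
        ((1 ⊗ₜ t) * TensorProduct.assoc k H H H (s ⊗ₜ 1))) = (1 ⊗ₜ evRLeft k g t) * s := by
    intro s t
    induction s using TensorProduct.induction_on with
    | zero => simp
    | add s s' hs hs' => simp only [TensorProduct.add_tmul, map_add, mul_add, hs, hs']
    | tmul a b =>
      induction t using TensorProduct.induction_on with
      | zero => simp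
      | add t t' ht ht' => simp only [TensorProduct.tmul_add, map_add, add_mul, ht, ht']
      | tmul c d => simp [Φ, TensorProduct.tmul_smul]
  rw [sourceMap_apply, h1, ← Coalgebra.coassoc_symm_apply, IsWeakBialgebra.comul_comul_one', h2]

/-- Applying `ε(· g) ⊗ id ⊗ ε(h ·)` to the two factorizations of `Δ²(1)` produces the two orders of
the product. -/
lemma targetMap_mul_sourceMap (g h : H) :
    targetMap k H g * sourceMap k H h = sourceMap k H h * targetMap k H g := by
  let Φ : H ⊗[k] (H ⊗[k] H) →ₗ[k] H :=
    (TensorProduct.lid k H).toLinearMap ∘ₗ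
      TensorProduct.map (ε ∘ₗ LinearMap.mulRight k g) (evRLeft k h)
  have h1 : ∀ s t : H ⊗[k] H, Φ (TensorProduct.assoc k H H H (s ⊗ₜ 1) * (1 ⊗ₜ t)) =
      evL k g s * evRLeft k h t := by
    intro s t
    induction s using TensorProduct.induction_on with
    | zero => simp
    | add s s' hs hs' => simp only [TensorProduct.add_tmul, map_add, add_mul, hs, hs']
    | tmul a b =>
      induction t using TensorProduct.induction_on with
      | zero => simp
      | add t t' ht ht' => simp only [TensorProduct.tmul_add, map_add, mul_add, ht, ht']
      | tmul c d => simp [Φ, smul_smul]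
  have h2 : ∀ s t : H ⊗[k] H, Φ ((1 ⊗ₜ t) * TensorProduct.assoc k H H H (s ⊗ₜ 1)) =
      evRLeft k h t * evL k g s := by
    intro s t
    induction s using TensorProduct.induction_on with
    | zero => simp
    | add s s' hs hs' => simp only [TensorProduct.add_tmul, map_add, mul_add, hs, hs']
    | tmul a b =>
      induction t using TensorProduct.induction_on with
      | zero => simp
      | add t t' ht ht' => simp only [TensorProduct.tmul_add, map_add, add_mul, ht, ht']
      | tmul c d => simp [Φ, smul_smul, mul_comm]
  rw [targetMap_apply, sourceMap_apply, ← h1, ← h2, ← IsWeakBialgebra.comul_comul_one,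
    ← IsWeakBialgebra.comul_comul_one']

lemma counit_sourceMap_mul (g h : H) : ε (sourceMap k H g * h) = ε (g * h) := by
  rw [counit_mul_eq' g h, sourceMap_apply]
  induction Δ (1 : H) using TensorProduct.induction_on with
  | zero => simp
  | add r r' hr hr' => simp only [map_add, hr, hr', add_mul]
  | tmul c d => simp

lemma sourceMap_sourceMap_mul (g h : H) :
    sourceMap k H (sourceMap k H g * h) = sourceMap k H (g * h) :=
  evRLeft_congr (fun x => by rw [mul_assoc, counit_sourceMap_mul, mul_assoc]) _

omit [IsWeakBialgebra k H] in
lemma evL_mul_tmul_one (g a : H) (t : H ⊗[k] H) :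
    evL k g (t * (a ⊗ₜ 1)) = evL k (a * g) t := by
  induction t using TensorProduct.induction_on with
  | zero => simp
  | add t t' ht ht' => simp only [map_add, add_mul, ht, ht']
  | tmul c d => simp [mul_assoc]

/-- `1₍₁₎ ⊗ ε_t(1₍₂₎) = 1₍₁₎ ⊗ 1₍₂₎`. -/
lemma lTensor_targetMap_comul_one : LinearMap.lTensor H (targetMap k H) (Δ 1) = Δ 1 := by
  have h1 : ∀ s : H ⊗[k] H, LinearMap.lTensor H (evL k 1)
      ((1 ⊗ₜ Δ 1) * TensorProduct.assoc k H H H (s ⊗ₜ 1)) =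
        LinearMap.lTensor H (targetMap k H) s := by
    intro s
    induction s using TensorProduct.induction_on with
    | zero => simp
    | add s s' hs hs' => simp only [TensorProduct.add_tmul, map_add, mul_add, hs, hs']
    | tmul a b => simp [evL_mul_tmul_one, targetMap_apply]
  rw [← h1, ← IsWeakBialgebra.comul_comul_one', ← LinearMap.comp_apply, ← LinearMap.lTensor_comp]
  have h2 : evL k 1 ∘ₗ Δ = LinearMap.id := LinearMap.ext evL_one_comul
  rw [h2, LinearMap.lTensor_id, LinearMap.id_apply]

namespace IsAntipode

variable {S : H →ₗ[k] H} (hS : IsAntipode k S)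
include hS

/-- Here `ε_t(g h) = ε_t(g ε_t(h))`, and `Δ(g ε_t(h)) = Δ(g)(ε_t(h) ⊗ 1)`; expanding `ε_t = id * S`
then gives `g₍₁₎ ε_t(h) S(g₍₂₎)`. -/
lemma targetMap_mul (g h : H) :
    targetMap k H (g * h) = conv k (LinearMap.mulRight k (targetMap k H h)) S g := by
  have h1 : ∀ (z : H) (s : H ⊗[k] H),
      LinearMap.mul' k H (TensorProduct.map LinearMap.id S (s * (z ⊗ₜ 1))) =
        LinearMap.mul' k H (TensorProduct.map (LinearMap.mulRight k z) S s) := by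
    intro z s
    induction s using TensorProduct.induction_on with
    | zero => simp
    | add s s' hs hs' => simp only [map_add, add_mul, hs, hs']
    | tmul a b => simp
  rw [← targetMap_mul_targetMap, ← LinearMap.congr_fun hS.conv_right]
  change LinearMap.mul' k H (TensorProduct.map LinearMap.id S (Δ _)) = _
  rw [comul_mul, comul_targetMap, ← mul_assoc, ← comul_mul, mul_one, h1]
  rfl

/-- The mirror image: `Δ(ε_s(g) h) = (1 ⊗ ε_s(g)) Δ(h)` and `ε_s = S * id` give `S(h₍₁₎) ε_s(g)
h₍₂₎`. -/
lemma sourceMap_mul (g h : H) :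
    sourceMap k H (g * h) = conv k S (LinearMap.mulLeft k (sourceMap k H g)) h := by
  have h1 : ∀ (z : H) (s : H ⊗[k] H),
      LinearMap.mul' k H (TensorProduct.map S LinearMap.id ((1 ⊗ₜ z) * s)) =
        LinearMap.mul' k H (TensorProduct.map S (LinearMap.mulLeft k z) s) := by
    intro z s
    induction s using TensorProduct.induction_on with
    | zero => simp
    | add s s' hs hs' => simp only [map_add, mul_add, hs, hs']
    | tmul a b => simp
  rw [← sourceMap_sourceMap_mul, ← LinearMap.congr_fun hS.conv_left]
  change LinearMap.mul' k H (TensorProduct.map S LinearMap.id (Δ _)) = _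
  rw [comul_mul, comul_sourceMap, mul_assoc, ← comul_mul, one_mul, h1]
  rfl

omit [IsWeakBialgebra k H] in
lemma conv_sourceMap : conv k (sourceMap k H) S = S := by
  rw [← hS.conv_left, hS.conv_conv]

omit [IsWeakBialgebra k H] in
lemma conv_targetMap : conv k S (targetMap k H) = S := by
  rw [← hS.conv_right, ← conv_assoc, hS.conv_conv]

/-- `ε_s(x h₍₁₎) S(h₍₂₎) = S(h) ε_s(x)`. -/
lemma conv_sourceMap_mulLeft (x : H) :
    conv k (sourceMap k H ∘ₗ LinearMap.mulLeft k x) S =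
      LinearMap.mulRight k (sourceMap k H x) ∘ₗ S := by
  have h1 : sourceMap k H ∘ₗ LinearMap.mulLeft k x =
      conv k S (LinearMap.mulLeft k (sourceMap k H x)) := by
    ext h; exact hS.sourceMap_mul x h
  -- `ε_s(x) h₍₁₎ S(h₍₂₎) = ε_s(x) ε_t(h) = ε_t(h) ε_s(x)`: commutation moves the factor to the far
  -- right, where `S * ε_t = S` finishes.
  have h2 : conv k (LinearMap.mulLeft k (sourceMap k H x)) S =
      LinearMap.mulRight k (sourceMap k H x) ∘ₗ targetMap k H := by
    ext h
    have r := Coalgebra.Repr.arbitrary k h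
    have := congr_arg (sourceMap k H x * ·) (LinearMap.congr_fun hS.conv_right h)
    beta_reduce at this
    rw [conv_apply_repr r, Finset.mul_sum] at this
    simp only [conv_apply_repr r, LinearMap.comp_apply, LinearMap.mulRight_apply,
      targetMap_mul_sourceMap, ← this, LinearMap.mulLeft_apply, mul_assoc, LinearMap.id_apply]
  rw [h1, conv_assoc, h2]
  ext h
  have r := Coalgebra.Repr.arbitrary k h
  have := LinearMap.congr_fun hS.conv_targetMap h
  rw [conv_apply_repr r] at this
  simp only [conv_apply_repr r, LinearMap.comp_apply, LinearMap.mulRight_apply, ← this,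
    Finset.sum_mul, mul_assoc]

/-- The antipode is antimultiplicative. -/
lemma map_mul (g h : H) : S (g * h) = S h * S g := by
  -- In the convolution algebra of maps `H ⊗ H → H`, both `P` and `N` behave as weak inverses of the
  -- multiplication `μ`; uniqueness of such an inverse is the claim.
  let P : WithConv (H ⊗[k] H →ₗ[k] H) := .toConv (S ∘ₗ LinearMap.mul' k H)
  let N : WithConv (H ⊗[k] H →ₗ[k] H) := .toConv
    (LinearMap.mul' k H ∘ₗ TensorProduct.map S S ∘ₗ (TensorProduct.comm k H H).toLinearMap)
  let μ : WithConv (H ⊗[k] H →ₗ[k] H) := .toConv (LinearMap.mul' k H)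
  let E : WithConv (H ⊗[k] H →ₗ[k] H) := .toConv (sourceMap k H ∘ₗ LinearMap.mul' k H)
  let T : WithConv (H ⊗[k] H →ₗ[k] H) := .toConv (targetMap k H ∘ₗ LinearMap.mul' k H)
  have hext : ∀ {f f' : WithConv (H ⊗[k] H →ₗ[k] H)},
      (∀ a b, f.ofConv (a ⊗ₜ b) = f'.ofConv (a ⊗ₜ b)) → f = f' := fun hf =>
    WithConv.ofConv_injective (TensorProduct.ext' hf)
  have hmul : ∀ (f f' : H →ₗ[k] H),
      -- Multiplicativity of `Δ` makes precomposition with `μ` respect convolution, so the relations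
      -- for `P` come from those for `S`.
      WithConv.toConv (f ∘ₗ LinearMap.mul' k H) * .toConv (f' ∘ₗ LinearMap.mul' k H) =
        .toConv (conv k f f' ∘ₗ LinearMap.mul' k H) := by
    intro f f'
    refine hext fun a b => ?_
    have r := Coalgebra.Repr.arbitrary k a
    have s := Coalgebra.Repr.arbitrary k b
    rw [convMul_apply_tmul r s]
    simp only [LinearMap.comp_apply, LinearMap.mul'_apply, conv, comul_mul]
    rw [← r.eq, ← s.eq]
    simp only [map_sum, Finset.sum_mul, Finset.mul_sum, Algebra.TensorProduct.tmul_mul_tmul,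
      TensorProduct.map_tmul, LinearMap.mul'_apply]
    exact Finset.sum_comm
  have hPμ : P * μ = E := (hmul S LinearMap.id).trans (by rw [hS.conv_left])
  have hμP : μ * P = T := (hmul LinearMap.id S).trans (by rw [hS.conv_right])
  have hEP : E * P = P := (hmul (sourceMap k H) S).trans (by rw [hS.conv_sourceMap])
  -- `a₍₁₎ b₍₁₎ S(b₍₂₎) S(a₍₂₎) = a₍₁₎ ε_t(b) S(a₍₂₎) = ε_t(a b)`.
  have hμN : μ * N = T := by
    refine hext fun a b => ?_
    have r := Coalgebra.Repr.arbitrary k a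
    have s := Coalgebra.Repr.arbitrary k b
    have := LinearMap.congr_fun hS.conv_right b
    rw [conv_apply_repr s] at this
    rw [convMul_apply_tmul r s]
    change _ = targetMap k H (a * b)
    rw [hS.targetMap_mul, conv_apply_repr r, ← this]
    simp [μ, N, Finset.mul_sum, Finset.sum_mul, mul_assoc]
  -- `ε_s(a₍₁₎ b₍₁₎) S(b₍₂₎) S(a₍₂₎) = S(b) ε_s(a₍₁₎) S(a₍₂₎) = S(b) S(a)`.
  have hEN : E * N = N := by
    refine hext fun a b => ?_
    have r := Coalgebra.Repr.arbitrary k a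
    have s := Coalgebra.Repr.arbitrary k b
    have h1 := fun x => LinearMap.congr_fun (hS.conv_sourceMap_mulLeft x) b
    have h2 := LinearMap.congr_fun hS.conv_sourceMap a
    simp only [conv_apply_repr s, LinearMap.comp_apply, LinearMap.mulRight_apply,
      LinearMap.mulLeft_apply] at h1
    rw [conv_apply_repr r] at h2
    rw [convMul_apply_tmul r s]
    change _ = S b * S a
    rw [← h2, Finset.mul_sum]
    refine Finset.sum_congr rfl fun i _ => ?_
    rw [← mul_assoc, ← h1, Finset.sum_mul]
    simp [E, N, mul_assoc]
  -- `P = E P = P μ P = P T = P μ N = E N = N`.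
  have hPN : P = N := by
    rw [← hEP, ← hPμ, mul_assoc, hμP, ← hμN, ← mul_assoc, hPμ, hEN]
  exact LinearMap.congr_fun (congr_arg WithConv.ofConv hPN) (g ⊗ₜ h)

/-- `S(ε̄_s(h)) = ε_t(h)`. -/
lemma map_sourceMapOp (h : H) : S (sourceMapOp k H h) = targetMap k H h := by
  have h2 : ∀ (z : H) (s : H ⊗[k] H),
      LinearMap.mul' k H (TensorProduct.map S LinearMap.id (s * (1 ⊗ₜ z))) =
        LinearMap.mul' k H (TensorProduct.map S LinearMap.id s) * z := by
    intro z s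
    induction s using TensorProduct.induction_on with
    | zero => simp
    | add s s' hs hs' => simp only [map_add, add_mul, hs, hs']
    | tmul a b => simp [mul_assoc]
  have h3 : ∀ (z : H) (s : H ⊗[k] H),
      LinearMap.mul' k H (TensorProduct.map S LinearMap.id (s * (z ⊗ₜ 1))) =
        S z * LinearMap.mul' k H (TensorProduct.map S LinearMap.id s) := by
    intro z s
    induction s using TensorProduct.induction_on with
    | zero => simp
    | add s s' hs hs' => simp only [map_add, add_mul, mul_add, hs, hs']
    | tmul a b => simp [mul_assoc, hS.map_mul]
  have h4 : LinearMap.mul' k H (TensorProduct.map S LinearMap.id (Δ 1)) = 1 :=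
    (LinearMap.congr_fun hS.conv_left 1).trans sourceMap_one
  -- Applying `a ⊗ b ↦ S(a) b` to `Δ(1)(1 ⊗ ε_t(h)) = Δ(1)(ε̄_s(h) ⊗ 1)` leaves `ε_s(1) ε_t(h)` on
  -- one side and, by antimultiplicativity, `S(ε̄_s(h)) ε_s(1)` on the other.
  have := congr_arg (fun t => LinearMap.mul' k H (TensorProduct.map S LinearMap.id t))
    (comul_one_mul_targetMap (k := k) h)
  beta_reduce at this
  rw [h2, h3, h4, one_mul, mul_one] at this
  exact this.symm

variable (T : H →ₗ[k] H) (hTS : ∀ h, T (S h) = h) (hST : ∀ h, S (T h) = h)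
include hTS hST

/-- `T(h₍₂₎) h₍₁₎ = T(ε_s(h))` for the inverse `T` of the antipode. -/
lemma mul_inverse_comm (h : H) :
    LinearMap.mul' k H (TensorProduct.map T LinearMap.id (TensorProduct.comm k H H (Δ h))) =
      T (sourceMap k H h) := by
  rw [← hS.conv_left]
  have r := Coalgebra.Repr.arbitrary k h
  rw [conv_apply_repr r, ← r.eq]
  -- The comparison is made after the injective map `S`, which turns `T(h₍₂₎) h₍₁₎` into `S(h₍₁₎)
  -- h₍₂₎`.
  apply Function.LeftInverse.injective hTS
  simp [map_sum, hS.map_mul, hST]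

/-- `h₍₂₎ T(h₍₁₎) = ε̄_s(h)` for the inverse `T` of the antipode. -/
lemma inverse_mul_comm (h : H) :
    LinearMap.mul' k H (TensorProduct.map LinearMap.id T (TensorProduct.comm k H H (Δ h))) =
      sourceMapOp k H h := by
  apply Function.LeftInverse.injective hTS
  rw [hS.map_sourceMapOp, ← hS.conv_right]
  have r := Coalgebra.Repr.arbitrary k h
  rw [conv_apply_repr r, ← r.eq]
  simp [map_sum, hS.map_mul, hST]

end IsAntipode

end Antipode

end
end WeakBialg

namespace WeakBialg

noncomputable section

/-! ### Computing in the ordinary tensor product -/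

section Inclusion

variable {k : Type u} {H : Type v} [CommRing k] [Ring H] [Algebra k H] [Coalgebra k H]
  [IsWeakBialgebra k H]
  {M N P : Type v} [AddCommGroup M] [Module k M] [Module H M] [IsScalarTower k H M]
  [AddCommGroup N] [Module k N] [Module H N] [IsScalarTower k H N]
  [AddCommGroup P] [Module k P] [Module H P] [IsScalarTower k H P]

local notation "Δ" => Coalgebra.comul (R := k) (A := H)

/-- Inside the ordinary tensor product, the associativity constraint is the ordinary one. -/
lemma incl_assocEquiv (x : TensorT k H (TensorT k H M N) P) :
    LinearMap.lTensor M (incl k H N P) (incl k H M _ (assocEquiv k H M N P x)) =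
      TensorProduct.assoc k M N P (LinearMap.rTensor P (incl k H M N) (incl k H _ P x)) := by
  have h1 : ∀ y : M ⊗[k] (N ⊗[k] P),
      LinearMap.lTensor M (incl k H N P) (LinearMap.lTensor M (proj k H N P) y) =
        tensorAct (Algebra.lsmul k k M) (act N P) ((1 : H) ⊗ₜ[k] Δ 1) y := by
    intro y
    induction y using TensorProduct.induction_on with
    | zero => simp
    | add s t hs ht => simp only [map_add, hs, ht]
    | tmul m s => simp [incl_proj]
  change LinearMap.lTensor M (incl k H N P) (act M _ (Δ (1 : H))
    (LinearMap.lTensor M (proj k H N P) _)) = _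
  -- The projection onto `N ⊗_t P` acts as `1 ⊗ Δ(1)`, which `Δ²(1)` absorbs; `Δ²(1)` in turn fixes
  -- an element already in the iterated `⊗_t`.
  rw [lTensor_coe_act, h1, ← Module.End.mul_apply, ← map_mul (tensorAct _ _), lTensor_comul_mul,
    ← Coalgebra.coassoc_apply, ← assoc_tensorAct, ← rTensor_coe_act, act_comul_one_incl]

variable (X : Type v) [AddCommGroup X] [Module k X] [Module H X] [IsScalarTower k H X]

variable (k H M) in
/-- `h ⊗ m ↦ x ↦ h x ⊗ m`. -/
def actOn : H ⊗[k] M →ₗ[k] X →ₗ[k] X ⊗[k] M :=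
  (LinearMap.rTensorHom M ∘ₗ (Algebra.lsmul k k X).toLinearMap.flip).flip

omit [Coalgebra k H] [IsWeakBialgebra k H] [Module H M] [IsScalarTower k H M] in
@[simp] lemma actOn_tmul (h : H) (m : M) (x : X) :
    actOn k H M X (h ⊗ₜ m) x = (h • x) ⊗ₜ m := rfl

omit [Coalgebra k H] [IsWeakBialgebra k H] in
lemma act_actOn (s : H ⊗[k] H) (t : H ⊗[k] M) (x : X) :
    act X M s (actOn k H M X t x) = actOn k H M X (act H M s t) x := by
  induction s using TensorProduct.induction_on with
  | zero => simp
  | add s s' hs hs' => simp only [map_add, LinearMap.add_apply, hs, hs']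
  | tmul a b =>
    induction t using TensorProduct.induction_on with
    | zero => simp
    | add s t hs ht => simp only [map_add, LinearMap.add_apply, hs, ht]
    | tmul c m => simp [mul_smul]

/-- `m ⊗ x ↦ m₍₋₁₎ x ⊗ m₍₀₎`. -/
def flipAct (lam : M →ₗ[k] H ⊗[k] M) : M ⊗[k] X →ₗ[k] X ⊗[k] M :=
  TensorProduct.lift (actOn k H M X ∘ₗ lam)

omit [Coalgebra k H] [IsWeakBialgebra k H] [Module H M] [IsScalarTower k H M] in
@[simp] lemma flipAct_tmul (lam : M →ₗ[k] H ⊗[k] M) (m : M) (x : X) :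
    flipAct X lam (m ⊗ₜ x) = actOn k H M X (lam m) x := rfl

omit [Coalgebra k H] [IsWeakBialgebra k H] [Module H M] [IsScalarTower k H M] in
-- This is what allows a coaction to be read off from a half-braiding at the regular module.
lemma actOn_one (t : H ⊗[k] M) : actOn k H M H t 1 = t := by
  induction t using TensorProduct.induction_on with
  | zero => simp
  | add s t hs ht => simp only [map_add, LinearMap.add_apply, hs, ht]
  | tmul c m => simp

omit [Coalgebra k H] [IsWeakBialgebra k H] in
-- With `g` the identity this yields naturality of the half-braiding in `X`; with `f` the identity
-- it relates colinear maps to morphisms of the center.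
lemma map_actOn {X Y M N : Type v} [AddCommGroup X] [Module k X] [Module H X] [IsScalarTower k H X]
    [AddCommGroup Y] [Module k Y] [Module H Y] [IsScalarTower k H Y]
    [AddCommGroup M] [Module k M] [AddCommGroup N] [Module k N]
    (f : X →ₗ[H] Y) (g : M →ₗ[k] N) (t : H ⊗[k] M) (x : X) :
    TensorProduct.map (f.restrictScalars k) g (actOn k H M X t x) =
      actOn k H N Y (LinearMap.lTensor H g t) (f x) := by
  induction t using TensorProduct.induction_on with
  | zero => simp
  | add s t hs ht => simp only [map_add, LinearMap.add_apply, hs, ht]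
  | tmul c m => simp

end Inclusion

/-! ### From Yetter-Drinfeld modules to half-braidings -/

section YDFacts

variable {k : Type u} {H : Type v} [CommRing k] [Ring H] [Algebra k H] [Coalgebra k H]
  [IsWeakBialgebra k H]

local notation "Δ" => Coalgebra.comul (R := k) (A := H)
local notation "ε" => Coalgebra.counit (R := k) (A := H)

omit [Coalgebra k H] [IsWeakBialgebra k H] in
-- Through this identity the Yetter-Drinfeld compatibility says that `m ⊗ x ↦ m₍₋₁₎ x ⊗ m₍₀₎`
-- commutes with the diagonal action of `H`.
lemma actOn_twist {M : LMod k H} (X : Type v) [AddCommGroup X] [Module k X] [Module H X]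
    [IsScalarTower k H X] (lam : M →ₗ[k] H ⊗[k] M) (m : M) (s : H ⊗[k] H) (x : X) :
    actOn k H M X (twist lam m s) x = flipAct X lam (act M X s (m ⊗ₜ x)) := by
  have h1 : ∀ (b : H) (t : H ⊗[k] M),
      actOn k H M X (LinearMap.rTensor M (LinearMap.mulRight k b) t) x =
      actOn k H M X t (b • x) := by
    intro b t
    induction t using TensorProduct.induction_on with
    | zero => simp
    | add s t hs ht => simp only [map_add, LinearMap.add_apply, hs, ht]
    | tmul c m => simp [mul_smul]
  induction s using TensorProduct.induction_on with
  | zero => simp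
  | add s t hs ht => simp only [map_add, LinearMap.add_apply, hs, ht]
  | tmul a b => simp [twist, h1]

namespace YetterDrinfeld

variable (A : YetterDrinfeld k H) (X Y : Type v) [AddCommGroup X] [Module k X] [Module H X]
  [IsScalarTower k H X] [AddCommGroup Y] [Module k Y] [Module H Y] [IsScalarTower k H Y]

omit [IsWeakBialgebra k H] in
lemma act_flipAct (h : H) (y : A.obj ⊗[k] X) :
    act X A.obj (Δ h) (flipAct X A.coact y) = flipAct X A.coact (act A.obj X (Δ h) y) := by
  induction y using TensorProduct.induction_on with
  | zero => simp
  | add s t hs ht => simp only [map_add, hs, ht]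
  | tmul m x => rw [flipAct_tmul, act_actOn, A.compat, actOn_twist]

/-- Since `λ(m) ∈ H ⊗_t M`, the image already lies in `X ⊗_t M` and projecting changes nothing. -/
lemma incl_proj_flipAct (y : A.obj ⊗[k] X) :
    incl k H X A.obj (proj k H X A.obj (flipAct X A.coact y)) = flipAct X A.coact y := by
  rw [incl_proj]
  induction y using TensorProduct.induction_on with
  | zero => simp
  | add s t hs ht => simp only [map_add, hs, ht]
  | tmul m x => rw [flipAct_tmul, act_actOn, act_comul_one_of_mem (A.mem m)]

/-- The compatibility at `h = 1` carries `Δ(1)` through the map, so the half-braiding can be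
evaluated on unprojected representatives. -/
lemma proj_flipAct_incl_proj (y : A.obj ⊗[k] X) :
    proj k H X A.obj (flipAct X A.coact (incl k H A.obj X (proj k H A.obj X y))) =
      proj k H X A.obj (flipAct X A.coact y) := by
  rw [incl_proj, ← act_flipAct, proj_act_comul, one_smul]

/-- The half-braiding `m ⊗ x ↦ m₍₋₁₎ x ⊗ m₍₀₎` of a Yetter-Drinfeld module. -/
def halfBraid : TensorT k H A.obj X →ₗ[H] TensorT k H X A.obj where
  toFun y := proj k H X A.obj (flipAct X A.coact (incl k H A.obj X y))
  map_add' x y := by simp only [map_add]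
  map_smul' h y := by rw [incl_smul, ← act_flipAct, proj_act_comul]; rfl

lemma halfBraid_proj (y : A.obj ⊗[k] X) :
    A.halfBraid X (proj k H A.obj X y) = proj k H X A.obj (flipAct X A.coact y) :=
  A.proj_flipAct_incl_proj X y

lemma incl_halfBraid_proj (y : A.obj ⊗[k] X) :
    incl k H X A.obj (A.halfBraid X (proj k H A.obj X y)) = flipAct X A.coact y := by
  rw [halfBraid_proj, incl_proj_flipAct]

/-- `ε(m₍₋₁₎ g) m₍₀₎ = ε̄_s(g) m`. -/
lemma counit_coact_mul (m : A.obj) (g : H) :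
    TensorProduct.lid k A.obj (LinearMap.rTensor A.obj (ε ∘ₗ LinearMap.mulRight k g) (A.coact m)) =
      sourceMapOp k H g • m := by
  have h1 : ∀ t : H ⊗[k] A.obj, LinearMap.rTensor A.obj (ε ∘ₗ LinearMap.mulRight k g) t =
      LinearMap.rTensor A.obj (ε ∘ₗ LinearMap.mulRight k (targetMap k H g)) t := by
    intro t
    congr 2
    ext h
    simp [counit_mul_targetMap]
  have h2 : ∀ s : H ⊗[k] H, ∀ z, LinearMap.rTensor A.obj (ε ∘ₗ LinearMap.mulRight k z)
      (twist A.coact m s) = LinearMap.rTensor A.obj ε (twist A.coact m (s * (1 ⊗ₜ z))) := by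
    intro s z
    induction s using TensorProduct.induction_on with
    | zero => simp
    | add s t hs ht => simp only [map_add, add_mul, hs, ht]
    | tmul a b =>
      simp only [twist, TensorProduct.lift.tmul, LinearMap.mk₂_apply,
        Algebra.TensorProduct.tmul_mul_tmul, mul_one]
      simp only [← LinearMap.rTensor_comp_apply]
      congr 2
      ext h
      simp [mul_assoc]
  have h3 : ∀ s : H ⊗[k] H, ∀ z, twist A.coact m (s * (z ⊗ₜ 1)) = twist A.coact (z • m) s := by
    intro s z
    induction s using TensorProduct.induction_on with
    | zero => simp
    | add s t hs ht => simp only [map_add, add_mul, hs, ht]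
    | tmul a b => simp [twist, mul_smul]
  have h4 : ∀ m, A.coact m = twist A.coact m (Δ 1) := fun m => by
    rw [← A.compat, act_comul_one_of_mem (A.mem m)]
  -- Under `ε` the element `g` may be replaced by `ε_t(g)`. Writing `λ(m)` as `(1₍₁₎ m)₍₋₁₎ 1₍₂₎ ⊗
  -- (1₍₁₎ m)₍₀₎` places `ε_t(g)` next to `1₍₂₎`; it crosses `Δ(1)` to become `ε̄_s(g)` acting on
  -- `m`, and counitality applies.
  rw [h1, h4, h2, comul_one_mul_targetMap, h3, ← h4, A.counit]

/-- `ε_t(m₍₋₁₎ g) m₍₀₎ = ε̄_s(g) m`. -/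
lemma targetMap_coact_mul (m : A.obj) (g : H) :
    TensorProduct.lift ((Algebra.lsmul k k A.obj).toLinearMap ∘ₗ targetMap k H ∘ₗ
      LinearMap.mulRight k g) (A.coact m) = sourceMapOp k H g • m := by
  have h1 : ∀ (s : H ⊗[k] H) (h : H) (n : A.obj), TensorProduct.lid k A.obj
      (LinearMap.rTensor A.obj (ε ∘ₗ LinearMap.mulRight k g) (act H A.obj s (h ⊗ₜ n))) =
        evL k (h * g) s • n := by
    intro s h n
    induction s using TensorProduct.induction_on with
    | zero => simp
    | add s t hs ht => simp only [map_add, LinearMap.add_apply, add_smul, hs, ht]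
    | tmul a b => simp [mul_assoc]
  rw [← counit_coact_mul, ← act_comul_one_of_mem (A.mem m)]
  -- `Δ(1)` is wanted only on the right, where `ε(1₍₁₎ m₍₋₁₎ g) 1₍₂₎ m₍₀₎ = ε_t(m₍₋₁₎ g) m₍₀₎`; the
  -- copy inserted on the left is removed.
  conv_lhs => rw [act_comul_one_of_mem (A.mem m)]
  induction A.coact m using TensorProduct.induction_on with
  | zero => simp
  | add s t hs ht => simp only [map_add, hs, ht]
  | tmul h n => rw [h1]; rfl

lemma halfBraid_unit : (leftUnitEquiv k H A.obj).toLinearMap ∘ₗ A.halfBraid (TargetSpace k H) =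
    (rightUnitEquiv k H A.obj).toLinearMap := by
  refine tensorT_hext fun m z => ?_
  simp only [LinearMap.comp_apply, LinearEquiv.coe_coe, rightUnitEquiv_proj, halfBraid_proj,
    flipAct_tmul]
  rw [← targetMap_coact_mul]
  induction A.coact m using TensorProduct.induction_on with
  | zero => simp
  | add s t hs ht => simp only [map_add, LinearMap.add_apply, hs, ht]
  | tmul c m => simp [targetIncl_smul]

/-- Both sides are the image under one map `Φ`, `h ⊗ g ⊗ n ↦ h x ⊗ g y ⊗ n`, of `(id ⊗ λ)λ(m)` and
of `(Δ ⊗ id)λ(m)` respectively, so the axiom reduces to coassociativity. -/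
lemma halfBraid_tensor :
    mapT LinearMap.id (A.halfBraid Y) ∘ₗ (assocEquiv k H X A.obj Y).toLinearMap ∘ₗ
        mapT (A.halfBraid X) LinearMap.id =
      (assocEquiv k H X Y A.obj).toLinearMap ∘ₗ A.halfBraid (TensorT k H X Y) ∘ₗ
        (assocEquiv k H A.obj X Y).toLinearMap := by
  refine tensorT_hext₃ fun m x y => ?_
  let Φ : H ⊗[k] (H ⊗[k] A.obj) →ₗ[k] TensorT k H X (TensorT k H Y A.obj) :=
    proj k H X _ ∘ₗ TensorProduct.map (LinearMap.toSpanSingleton H X x |>.restrictScalars k)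
      (proj k H Y A.obj ∘ₗ (actOn k H A.obj Y).flip y)
  have h1 : ∀ t : H ⊗[k] A.obj,
      mapT LinearMap.id (A.halfBraid Y) (assocEquiv k H X A.obj Y
        (proj k H _ Y (proj k H X A.obj (actOn k H A.obj X t x) ⊗ₜ y))) =
      Φ (LinearMap.lTensor H A.coact t) := by
    intro t
    induction t using TensorProduct.induction_on with
    | zero => simp
    | add s t hs ht =>
      simp only [map_add, LinearMap.add_apply, TensorProduct.add_tmul, hs, ht]
    | tmul h n => simp [Φ, halfBraid_proj]
  have h2 : ∀ t : H ⊗[k] A.obj,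
      assocEquiv k H X Y A.obj (proj k H _ A.obj
        (actOn k H A.obj (TensorT k H X Y) t (proj k H X Y (x ⊗ₜ y)))) =
      Φ (TensorProduct.assoc k H H A.obj (LinearMap.rTensor A.obj Δ t)) := by
    intro t
    induction t using TensorProduct.induction_on with
    | zero => simp
    | add s t hs ht =>
      simp only [map_add, LinearMap.add_apply, hs, ht]
    | tmul h n =>
      rw [actOn_tmul, ← proj_act_comul, LinearMap.rTensor_tmul]
      induction Δ h using TensorProduct.induction_on with
      | zero => simp
      | add s t hs ht =>
        simp only [map_add, LinearMap.add_apply, TensorProduct.add_tmul, hs, ht]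
      | tmul a b => simp [Φ]
  simp only [LinearMap.comp_apply, LinearEquiv.coe_coe, mapT_proj, assocEquiv_proj,
    halfBraid_proj, flipAct_tmul, LinearMap.id_apply]
  rw [h1, h2, A.coassoc]

variable {X Y} in
lemma halfBraid_naturality (f : X →ₗ[H] Y) :
    A.halfBraid Y ∘ₗ mapT LinearMap.id f = mapT f LinearMap.id ∘ₗ A.halfBraid X := by
  refine tensorT_hext fun m x => ?_
  apply incl_injective
  rw [LinearMap.comp_apply, LinearMap.comp_apply, mapT_proj, incl_mapT, incl_halfBraid_proj,
    incl_halfBraid_proj, flipAct_tmul, flipAct_tmul, map_actOn]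
  exact congr_arg (fun t => actOn k H A.obj Y t (f x))
    (LinearMap.congr_fun (LinearMap.lTensor_id H A.obj) (A.coact m)).symm

end YetterDrinfeld
end YDFacts

end
end WeakBialg

namespace WeakBialg

noncomputable section

/-! ### Isomorphisms of categories from bijections on objects -/

section CatIso

universe v₁ u₁

/-- A fully faithful functor that is bijective on objects is an isomorphism of categories. -/
lemma nonempty_cat_iso_of_bijective_obj {C D : Type u₁} [Category.{v₁} C] [Category.{v₁} D]
    (F : C ⥤ D) [F.Full] [F.Faithful] (hF : Function.Bijective F.obj) :
    Nonempty (Cat.of C ≅ Cat.of D) := by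
  let e := Equiv.ofBijective F.obj hF
  have he : ∀ Y, F.obj (e.symm Y) = Y := e.apply_symm_apply
  have he' : ∀ X, e.symm (F.obj X) = X := e.symm_apply_apply
  -- Since `F (e.symm Y)` equals `Y` only propositionally, morphisms are conjugated by `eqToHom`
  -- before being lifted along `F`.
  let G : D ⥤ C :=
    { obj := e.symm
      map := fun {Y Z} f => F.preimage (eqToHom (he Y) ≫ f ≫ eqToHom (he Z).symm)
      map_id := fun Y => F.map_injective (by simp)
      map_comp := fun f g => F.map_injective (by simp) }
  have hFG : F ⋙ G = 𝟭 C := CategoryTheory.Functor.ext he' fun X Y f => F.map_injective (by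
    simp [G, eqToHom_map])
  have hGF : G ⋙ F = 𝟭 D := CategoryTheory.Functor.ext he fun X Y f => by simp [G]
  exact ⟨⟨F.toCatHom, G.toCatHom, by
    ext1; exact hFG, by ext1; exact hGF⟩⟩

end CatIso

variable {k : Type u} {H : Type v} [CommRing k] [Ring H] [Algebra k H] [Coalgebra k H]
  [IsWeakBialgebra k H]

local notation "Δ" => Coalgebra.comul (R := k) (A := H)
local notation "ε" => Coalgebra.counit (R := k) (A := H)

/-! ### The fully faithful functor to the weak left center -/

namespace YetterDrinfeld

/-- The object of the weak left center given by a Yetter-Drinfeld module. -/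
@[simps obj]
def toCenter (A : YetterDrinfeld k H) : WeakLeftCenter (LMod k H) where
  obj := A.obj
  σ X := ⟨A.halfBraid X⟩
  naturality f := LMod.hom_ext (A.halfBraid_naturality f.hom)
  tensor X Y := LMod.hom_ext (A.halfBraid_tensor X Y)
  unit := by
    refine (Iso.eq_comp_inv (λ_ A.obj)).2 ?_
    exact LMod.hom_ext A.halfBraid_unit

lemma Hom.comm_halfBraid {A B : YetterDrinfeld k H} (f : Hom A B) (X : Type v) [AddCommGroup X]
    [Module k X] [Module H X] [IsScalarTower k H X] :
    mapT LinearMap.id f.hom ∘ₗ A.halfBraid X = B.halfBraid X ∘ₗ mapT f.hom LinearMap.id := by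
  refine tensorT_hext fun m x => ?_
  apply incl_injective
  rw [LinearMap.comp_apply, LinearMap.comp_apply, mapT_proj, incl_mapT, incl_halfBraid_proj,
    incl_halfBraid_proj, flipAct_tmul, flipAct_tmul, map_actOn, f.colinear]

/-- The coaction is recovered from the half-braiding at `H`; both fullness and the round trip on
objects use this. -/
lemma incl_halfBraid_one (A : YetterDrinfeld k H) (m : A.obj) :
    incl k H H A.obj (A.halfBraid H (proj k H A.obj H (m ⊗ₜ 1))) = A.coact m := by
  rw [incl_halfBraid_proj, flipAct_tmul, actOn_one]

/-- Evaluate the single square at `X = H` on the class of `m ⊗ 1`. -/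
lemma colinear_of_comm {A B : YetterDrinfeld k H} (f : A.obj →ₗ[H] B.obj)
    (hf : mapT LinearMap.id f ∘ₗ A.halfBraid H = B.halfBraid H ∘ₗ mapT f LinearMap.id)
    (m : A.obj) :
    B.coact (f m) = LinearMap.lTensor H (f.restrictScalars k) (A.coact m) := by
  have := congr_arg (incl k H H B.obj)
    (LinearMap.congr_fun hf (proj k H A.obj H (m ⊗ₜ 1)))
  rw [LinearMap.comp_apply, LinearMap.comp_apply, mapT_proj, LinearMap.id_apply,
    incl_halfBraid_one, incl_mapT, incl_halfBraid_one] at this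
  exact this.symm

variable (k H) in
/-- The functor from Yetter-Drinfeld modules to the weak left center. -/
@[simps obj]
def centerFunctor : YetterDrinfeld k H ⥤ WeakLeftCenter (LMod k H) where
  obj A := A.toCenter
  map f := ⟨⟨Hom.hom f⟩, fun X => LMod.hom_ext (Hom.comm_halfBraid f X)⟩
  map_id _ := rfl
  map_comp _ _ := rfl

instance : (centerFunctor k H).Faithful where
  map_injective h := Hom.ext (congr_arg (fun t => LMod.Hom.hom (WeakLeftCenter.Hom.hom t)) h)

instance : (centerFunctor k H).Full where
  map_surjective g := ⟨⟨(WeakLeftCenter.Hom.hom g).hom, colinear_of_comm _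
    (congr_arg LMod.Hom.hom (WeakLeftCenter.Hom.comm g ⟨H⟩))⟩, rfl⟩

end YetterDrinfeld

/-! ### From half-braidings to Yetter-Drinfeld modules -/

namespace WeakLeftCenter

variable (B : WeakLeftCenter (LMod k H))

/-- The components of the natural transformation, as linear maps. -/
def braid (X : Type v) [AddCommGroup X] [Module k X] [Module H X] [IsScalarTower k H X] :
    TensorT k H B.obj X →ₗ[H] TensorT k H X B.obj :=
  (B.σ ⟨X⟩).hom

variable {X Y : Type v} [AddCommGroup X] [Module k X] [Module H X]
  [IsScalarTower k H X] [AddCommGroup Y] [Module k Y] [Module H Y] [IsScalarTower k H Y]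

lemma braid_mapT (f : X →ₗ[H] Y) (y : TensorT k H B.obj X) :
    B.braid Y (mapT LinearMap.id f y) = mapT f LinearMap.id (B.braid X y) :=
  LinearMap.congr_fun (congr_arg LMod.Hom.hom
    (B.naturality (X := ⟨X⟩) (Y := ⟨Y⟩) ⟨f⟩)) y

lemma braid_tensor (y : TensorT k H (TensorT k H B.obj X) Y) :
    mapT LinearMap.id (B.braid Y) (assocEquiv k H X B.obj Y (mapT (B.braid X) LinearMap.id y)) =
      assocEquiv k H X Y B.obj (B.braid (TensorT k H X Y) (assocEquiv k H B.obj X Y y)) :=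
  LinearMap.congr_fun (congr_arg LMod.Hom.hom (B.tensor ⟨X⟩ ⟨Y⟩)) y

lemma leftUnitEquiv_braid (y : TensorT k H B.obj (TargetSpace k H)) :
    leftUnitEquiv k H B.obj (B.braid (TargetSpace k H) y) = rightUnitEquiv k H B.obj y :=
  LinearMap.congr_fun (congr_arg LMod.Hom.hom ((Iso.eq_comp_inv _).1 B.unit)) y

/-- The coaction `m ↦ σ_H(1₍₁₎ m ⊗ 1₍₂₎)`. -/
def coaction : B.obj →ₗ[k] H ⊗[k] B.obj :=
  incl k H H B.obj ∘ₗ (B.braid H).restrictScalars k ∘ₗ proj k H B.obj H ∘ₗ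
    (TensorProduct.mk k B.obj H).flip 1

lemma incl_braid_one (m : B.obj) :
    incl k H H B.obj (B.braid H (proj k H B.obj H (m ⊗ₜ 1))) = B.coaction m := rfl

-- The Yoneda-type step: naturality along `h ↦ h x` from `H` to `X` expresses every component of `σ`
-- through its value on the class of `m ⊗ 1`.
variable (X) in
lemma incl_braid_proj (y : B.obj ⊗[k] X) :
    incl k H X B.obj (B.braid X (proj k H B.obj X y)) = flipAct X B.coaction y := by
  induction y using TensorProduct.induction_on with
  | zero => simp
  | add s t hs ht => simp only [map_add, hs, ht]
  | tmul m x =>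
    have : proj k H B.obj X (m ⊗ₜ x) =
        mapT LinearMap.id (LinearMap.toSpanSingleton H X x) (proj k H B.obj H (m ⊗ₜ 1)) := by
      simp
    rw [this, braid_mapT, incl_mapT, ← actOn_one (incl k H H B.obj _), incl_braid_one,
      map_actOn, flipAct_tmul]
    simp only [LinearMap.toSpanSingleton_apply, one_smul]
    exact congr_arg (fun t => actOn k H B.obj X t x)
      (LinearMap.congr_fun (LinearMap.lTensor_id H B.obj) _)

variable (X) in
lemma incl_braid (y : TensorT k H B.obj X) :
    incl k H X B.obj (B.braid X y) = flipAct X B.coaction (incl k H B.obj X y) := by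
  rw [← incl_braid_proj, proj_incl]

lemma flipAct_act_comul (h : H) (y : B.obj ⊗[k] X) :
    flipAct X B.coaction (act B.obj X (Δ h) y) = act X B.obj (Δ h) (flipAct X B.coaction y) := by
  rw [← incl_braid_proj, ← incl_braid_proj, proj_act_comul, map_smul, incl_smul]

lemma coaction_mem (m : B.obj) : B.coaction m ∈ tensorT k H H B.obj :=
  (B.braid H (proj k H B.obj H (m ⊗ₜ 1))).2

/-- This is `H`-linearity of `σ_H`, evaluated at `m ⊗ 1`. -/
lemma coaction_compat (h : H) (m : B.obj) :
    act H B.obj (Δ h) (B.coaction m) = twist B.coaction m (Δ h) := by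
  have := B.flipAct_act_comul h (m ⊗ₜ[k] (1 : H))
  rw [flipAct_tmul, actOn_one] at this
  rw [← this, ← actOn_twist, actOn_one]

variable (k H) in
/-- The target map `H → H_t`, as a map of left `H`-modules. -/
def targetHom : H →ₗ[H] TargetSpace k H where
  toFun h := ⟨targetMap k H h, h, rfl⟩
  map_add' _ _ := targetIncl_ext
    ((map_add (targetMap k H) _ _).trans (map_add (targetIncl k H) ⟨_, _⟩ ⟨_, _⟩).symm)
  map_smul' h g := targetIncl_ext (targetMap_mul_targetMap (k := k) h g).symm

lemma targetIncl_targetHom (h : H) : targetIncl k H (targetHom k H h) = targetMap k H h := rfl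

/-- Naturality along the `H`-linear map `ε_t : H → H_t` transfers the computation to the unit
object, where `σ` is known. On `H ⊗_t M`, applying `ε_t` and then the left unit constraint is `ε ⊗
id`, because `ε(1₍₁₎ h) 1₍₂₎ n = ε_t(h) n`. -/
lemma coaction_counit (m : B.obj) :
    TensorProduct.lid k B.obj (LinearMap.rTensor B.obj ε (B.coaction m)) = m := by
  have h1 : ∀ (s : H ⊗[k] H) (h : H) (n : B.obj), TensorProduct.lid k B.obj
      (LinearMap.rTensor B.obj ε (act H B.obj s (h ⊗ₜ n))) = evL k h s • n := by
    intro s h n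
    induction s using TensorProduct.induction_on with
    | zero => simp
    | add s t hs ht => simp only [map_add, LinearMap.add_apply, add_smul, hs, ht]
    | tmul a b => simp
  have h2 : ∀ t : TensorT k H H B.obj,
      leftUnitEquiv k H B.obj (mapT (targetHom k H) LinearMap.id t) =
        TensorProduct.lid k B.obj (LinearMap.rTensor B.obj ε (incl k H H B.obj t)) := by
    intro t
    induction t using proj_induction with
    | h0 => simp
    | hadd x y hx hy => simp only [map_add, hx, hy]
    | h h n =>
      rw [incl_proj, h1, mapT_proj, leftUnitEquiv_proj, targetIncl_targetHom]; rfl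
  rw [← incl_braid_one, ← h2, ← braid_mapT, leftUnitEquiv_braid, mapT_proj, rightUnitEquiv_proj,
    targetIncl_targetHom, targetMap_one, sourceMapOp_one, one_smul]; rfl

/-- The tensor axiom at `X = Y = H`, evaluated on the class of `(m ⊗ 1) ⊗ 1` and read in `H ⊗ H ⊗
M`. -/
lemma coaction_coassoc (m : B.obj) :
    TensorProduct.assoc k H H B.obj (LinearMap.rTensor B.obj Δ (B.coaction m)) =
      LinearMap.lTensor H B.coaction (B.coaction m) := by
  let y : TensorT k H H B.obj := B.braid H (proj k H B.obj H (m ⊗ₜ 1))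
  have key := B.braid_tensor (proj k H _ H (proj k H B.obj H (m ⊗ₜ 1) ⊗ₜ (1 : H)))
  rw [mapT_proj, assocEquiv_proj] at key
  have h1 : ∀ t : H ⊗[k] TensorT k H B.obj H, LinearMap.lTensor H (incl k H H B.obj)
      (TensorProduct.map ((LinearMap.id : H →ₗ[H] H).restrictScalars k)
        ((B.braid H).restrictScalars k) t) =
        LinearMap.lTensor H (flipAct H B.coaction) (LinearMap.lTensor H (incl k H B.obj H) t) := by
    intro t
    induction t using TensorProduct.induction_on with
    | zero => simp
    | add s t hs ht => simp only [map_add, hs, ht]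
    | tmul h x => simp [incl_braid]
  have h2 : ∀ t : H ⊗[k] B.obj, tensorAct (act H B.obj) (Algebra.lsmul k k H) (Δ 1 ⊗ₜ[k] (1 : H))
      (t ⊗ₜ (1 : H)) = act H B.obj (Δ 1) t ⊗ₜ (1 : H) := fun t => by simp
  have h3 : ∀ t : H ⊗[k] B.obj, LinearMap.lTensor H (flipAct H B.coaction)
      (tensorAct (Algebra.lsmul k k H) (act B.obj H) ((1 : H) ⊗ₜ[k] Δ 1)
        (TensorProduct.assoc k H B.obj H (t ⊗ₜ (1 : H)))) = LinearMap.lTensor H B.coaction t := by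
    intro t
    induction t using TensorProduct.induction_on with
    | zero => simp
    | add s t hs ht => simp only [map_add, TensorProduct.add_tmul, hs, ht]
    | tmul h n =>
      simp [flipAct_act_comul, actOn_one, act_comul_one_of_mem (B.coaction_mem n)]
  have hl : LinearMap.lTensor H (incl k H H B.obj) (incl k H H _
      (mapT LinearMap.id (B.braid H) (assocEquiv k H H B.obj H (proj k H _ H (y ⊗ₜ (1 : H)))))) =
      LinearMap.lTensor H B.coaction (B.coaction m) := by
    -- `Δ²(1)` is split as `(1 ⊗ Δ(1))(Δ(1) ⊗ 1)`. The factor `Δ(1) ⊗ 1` fixes `y ∈ H ⊗_t M`, and `1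
    -- ⊗ Δ(1)` is absorbed by `h3`, since `λ` takes values in `H ⊗_t M`.
    rw [incl_mapT, h1, incl_assocEquiv, incl_proj, rTensor_coe_act, assoc_tensorAct,
      Coalgebra.coassoc_apply, IsWeakBialgebra.comul_comul_one', map_mul, Module.End.mul_apply,
      LinearMap.rTensor_tmul, ← assoc_tensorAct, h2, act_comul_one_incl, h3]
    rfl
  have hr : LinearMap.lTensor H (incl k H H B.obj) (incl k H H _ (assocEquiv k H H H B.obj
      (B.braid (TensorT k H H H) (proj k H B.obj _ (m ⊗ₜ proj k H H H (1 ⊗ₜ 1)))))) =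
      TensorProduct.assoc k H H B.obj (LinearMap.rTensor B.obj Δ (B.coaction m)) := by
    -- The class of `1 ⊗ 1` in `H ⊗_t H` is `Δ(1)`, and `a` acts on it to give `Δ(a) Δ(1) = Δ(a)`;
    -- this is how `Δ ⊗ id` appears.
    rw [incl_assocEquiv, incl_braid_proj, flipAct_tmul]
    congr 1
    induction B.coaction m using TensorProduct.induction_on with
    | zero => simp
    | add s t hs ht => simp only [map_add, LinearMap.add_apply, hs, ht]
    | tmul a n =>
      rw [actOn_tmul, LinearMap.rTensor_tmul, incl_smul, incl_proj, ← Module.End.mul_apply,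
        ← map_mul, ← comul_mul, mul_one, LinearMap.rTensor_tmul]
      congr 1
      induction Δ a using TensorProduct.induction_on with
      | zero => simp
      | add s t hs ht => simp only [map_add, LinearMap.add_apply, hs, ht]
      | tmul c d => simp
  rw [← hl, ← hr]
  exact congr_arg (fun t => LinearMap.lTensor H (incl k H H B.obj) (incl k H H _ t)) key.symm

/-- The Yetter-Drinfeld module given by an object of the weak left center. -/
@[simps]
def toYetterDrinfeld : YetterDrinfeld k H where
  obj := B.obj
  coact := B.coaction
  coassoc := B.coaction_coassoc
  counit := B.coaction_counit
  mem := B.coaction_mem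
  compat := B.coaction_compat

lemma toCenter_toYetterDrinfeld : B.toYetterDrinfeld.toCenter = B := by
  -- The underlying objects agree definitionally, so equality of objects reduces to equality of `σ`.
  change WeakLeftCenter.mk B.obj _ _ _ _ = WeakLeftCenter.mk B.obj B.σ _ _ _
  congr 1
  funext X
  refine LMod.hom_ext (tensorT_hext fun m x => incl_injective ?_)
  exact (B.toYetterDrinfeld.incl_halfBraid_proj X _).trans (B.incl_braid_proj X _).symm

lemma toYetterDrinfeld_toCenter (A : YetterDrinfeld k H) : A.toCenter.toYetterDrinfeld = A := by
  change YetterDrinfeld.mk A.obj _ _ _ _ _ = YetterDrinfeld.mk A.obj A.coact _ _ _ _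
  congr 1
  ext m
  exact A.incl_halfBraid_one m

end WeakLeftCenter

lemma YetterDrinfeld.bijective_toCenter : Function.Bijective (centerFunctor k H).obj :=
  Function.bijective_iff_has_inverse.2 ⟨WeakLeftCenter.toYetterDrinfeld,
    WeakLeftCenter.toYetterDrinfeld_toCenter, WeakLeftCenter.toCenter_toYetterDrinfeld⟩

end

end WeakBialg

/-! ### Invertibility of half-braidings for a bijective antipode -/

namespace WeakBialg

noncomputable section

variable {k : Type u} {H : Type v} [CommRing k] [Ring H] [Algebra k H] [Coalgebra k H]
  [IsWeakBialgebra k H]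

local notation "Δ" => Coalgebra.comul (R := k) (A := H)
local notation "ε" => Coalgebra.counit (R := k) (A := H)

/-- The exchange rule across `⊗_t`, for arbitrary `h` rather than `z ∈ H_t`: take `z = ε_t(h)` and
use `ε̄_s ∘ ε_t = ε̄_s`. -/
lemma proj_sourceMapOp_smul_tmul {M N : Type v} [AddCommGroup M] [Module k M] [Module H M]
    [IsScalarTower k H M] [AddCommGroup N] [Module k N] [Module H N] [IsScalarTower k H N]
    (h : H) (m : M) (n : N) :
    proj k H M N ((sourceMapOp k H h • m) ⊗ₜ n) = proj k H M N (m ⊗ₜ (targetMap k H h • n)) := by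
  have := proj_tmul_targetSpace_smul (k := k) m n (WeakLeftCenter.targetHom k H h)
  rwa [WeakLeftCenter.targetIncl_targetHom, sourceMapOp_targetMap, eq_comm] at this

namespace YetterDrinfeld

variable (A : YetterDrinfeld k H) (T : H →ₗ[k] H) (X : Type v) [AddCommGroup X] [Module k X]
  [Module H X] [IsScalarTower k H X]

/-- `x ⊗ m ↦ m₍₀₎ ⊗ T(m₍₋₁₎) x`. -/
def flipInv : X ⊗[k] A.obj →ₗ[k] A.obj ⊗[k] X :=
  TensorProduct.lift ((actOn k H A.obj X ∘ₗ LinearMap.rTensor A.obj T ∘ₗ A.coact).compr₂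
    (TensorProduct.comm k X A.obj).toLinearMap).flip

omit [IsWeakBialgebra k H] in
lemma flipInv_tmul (x : X) (m : A.obj) : A.flipInv T X (x ⊗ₜ m) =
    TensorProduct.comm k X A.obj (actOn k H A.obj X (LinearMap.rTensor A.obj T (A.coact m)) x) :=
  rfl

/-- `h ⊗ (g ⊗ n) ↦ φ(h ⊗ g) x ⊗ n`. -/
def actOnTwo (φ : H ⊗[k] H →ₗ[k] H) (x : X) : H ⊗[k] (H ⊗[k] A.obj) →ₗ[k] X ⊗[k] A.obj :=
  (actOn k H A.obj X).flip x ∘ₗ LinearMap.rTensor A.obj φ ∘ₗ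
    (TensorProduct.assoc k H H A.obj).symm.toLinearMap

variable {X}

omit [IsWeakBialgebra k H] in
-- Coassociativity replaces two successive coactions by one coaction followed by `Δ`, so composing
-- the two flips amounts to evaluating `φ ∘ Δ` on `m₍₋₁₎`.
lemma actOnTwo_lTensor_coact (φ : H ⊗[k] H →ₗ[k] H) (x : X) (m : A.obj) :
    A.actOnTwo X φ x (LinearMap.lTensor H A.coact (A.coact m)) =
      actOn k H A.obj X (LinearMap.rTensor A.obj (φ ∘ₗ Δ) (A.coact m)) x := by
  rw [← A.coassoc, LinearMap.rTensor_comp_apply]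
  simp [actOnTwo]

omit [IsWeakBialgebra k H] in
lemma flipInv_flipAct (x : X) (m : A.obj) :
    A.flipInv T X (flipAct X A.coact (m ⊗ₜ x)) = TensorProduct.comm k X A.obj
      (actOn k H A.obj X (LinearMap.rTensor A.obj (LinearMap.mul' k H ∘ₗ
        TensorProduct.map T LinearMap.id ∘ₗ (TensorProduct.comm k H H).toLinearMap ∘ₗ Δ)
          (A.coact m)) x) := by
  let φ : H ⊗[k] H →ₗ[k] H := LinearMap.mul' k H ∘ₗ
    TensorProduct.map T LinearMap.id ∘ₗ (TensorProduct.comm k H H).toLinearMap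
  have h1 : ∀ t : H ⊗[k] A.obj, A.flipInv T X (actOn k H A.obj X t x) =
      TensorProduct.comm k X A.obj (A.actOnTwo X φ x (LinearMap.lTensor H A.coact t)) := by
    intro t
    induction t using TensorProduct.induction_on with
    | zero => simp
    | add s t hs ht => simp only [map_add, LinearMap.add_apply, hs, ht]
    | tmul h n =>
      rw [actOn_tmul, flipInv_tmul, LinearMap.lTensor_tmul]
      induction A.coact n using TensorProduct.induction_on with
      | zero => simp
      | add s t hs ht =>
        simp only [map_add, LinearMap.add_apply, TensorProduct.tmul_add, hs, ht]
      | tmul g n => simp [actOnTwo, φ, mul_smul]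
  rw [flipAct_tmul, h1, actOnTwo_lTensor_coact]
  rfl

omit [IsWeakBialgebra k H] in
lemma flipAct_flipInv (x : X) (m : A.obj) :
    flipAct X A.coact (A.flipInv T X (x ⊗ₜ m)) =
      actOn k H A.obj X (LinearMap.rTensor A.obj (LinearMap.mul' k H ∘ₗ
        TensorProduct.map LinearMap.id T ∘ₗ (TensorProduct.comm k H H).toLinearMap ∘ₗ Δ)
          (A.coact m)) x := by
  let φ : H ⊗[k] H →ₗ[k] H := LinearMap.mul' k H ∘ₗ
    TensorProduct.map LinearMap.id T ∘ₗ (TensorProduct.comm k H H).toLinearMap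
  have h1 : ∀ t : H ⊗[k] A.obj, flipAct X A.coact (TensorProduct.comm k X A.obj
      (actOn k H A.obj X (LinearMap.rTensor A.obj T t) x)) =
        A.actOnTwo X φ x (LinearMap.lTensor H A.coact t) := by
    intro t
    induction t using TensorProduct.induction_on with
    | zero => simp
    | add s t hs ht => simp only [map_add, LinearMap.add_apply, hs, ht]
    | tmul h n =>
      rw [LinearMap.rTensor_tmul, actOn_tmul, TensorProduct.comm_tmul, flipAct_tmul,
        LinearMap.lTensor_tmul]
      induction A.coact n using TensorProduct.induction_on with
      | zero => simp
      | add s t hs ht =>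
        simp only [map_add, LinearMap.add_apply, TensorProduct.tmul_add, hs, ht]
      | tmul g n => simp [actOnTwo, φ, mul_smul]
  rw [flipInv_tmul, h1, actOnTwo_lTensor_coact]
  rfl

variable {S : H →ₗ[k] H} (hS : IsAntipode k S) {T} (hTS : ∀ h, T (S h) = h)
  (hST : ∀ h, S (T h) = h)
include hS hTS hST

/-- After projection, `m₍₀₎ ⊗ T(ε_s(m₍₋₁₎)) x = ε(m₍₋₁₎ 1₍₂₎) m₍₀₎ ⊗ T(1₍₁₎) x = ε̄_s(1₍₂₎) m ⊗
T(1₍₁₎) x = m ⊗ ε_t(1₍₂₎) T(1₍₁₎) x`. Here `ε_t` can be dropped, and `1₍₂₎ T(1₍₁₎) = ε̄_s(1) = 1`.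
-/
lemma proj_flipInv_flipAct (y : A.obj ⊗[k] X) :
    proj k H A.obj X (A.flipInv T X (flipAct X A.coact y)) = proj k H A.obj X y := by
  induction y using TensorProduct.induction_on with
  | zero => simp
  | add s t hs ht => simp only [map_add, hs, ht]
  | tmul m x =>
    have h1 : LinearMap.mul' k H ∘ₗ TensorProduct.map T LinearMap.id ∘ₗ
        (TensorProduct.comm k H H).toLinearMap ∘ₗ Δ = T ∘ₗ sourceMap k H :=
      LinearMap.ext fun h => hS.mul_inverse_comm T hTS hST h
    let β : H ⊗[k] A.obj →ₗ[k] H →ₗ[k] A.obj := (actOn k H A.obj H).compr₂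
      ((TensorProduct.lid k A.obj).toLinearMap ∘ₗ LinearMap.rTensor A.obj ε)
    -- For `t = h ⊗ n`, `β` sends `b` to `ε(h b) n` and `Ω` sends `a ⊗ b` to `ε(h b) n ⊗ T(a) x`.
    let Ω : H ⊗[k] A.obj → H ⊗[k] H →ₗ[k] A.obj ⊗[k] X := fun t =>
      (TensorProduct.comm k X A.obj).toLinearMap ∘ₗ
        TensorProduct.map ((LinearMap.toSpanSingleton H X x).restrictScalars k ∘ₗ T) (β t)
    have h2 : ∀ t : H ⊗[k] A.obj, TensorProduct.comm k X A.obj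
        (actOn k H A.obj X (LinearMap.rTensor A.obj (T ∘ₗ sourceMap k H) t) x) = Ω t (Δ 1) := by
      intro t
      induction t using TensorProduct.induction_on with
      | zero => simp [Ω]
      | add s t hs ht =>
        simp only [map_add, LinearMap.add_apply, hs, ht, Ω, TensorProduct.map_add_right,
          LinearMap.comp_add]
      | tmul h n =>
        rw [LinearMap.rTensor_tmul, actOn_tmul, LinearMap.comp_apply, sourceMap_apply]
        induction Δ (1 : H) using TensorProduct.induction_on with
        | zero => simp
        | add s t hs ht =>
          simp only [map_add, add_smul, TensorProduct.add_tmul, hs, ht]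
        | tmul a b => simp [Ω, β, TensorProduct.tmul_smul]
    have h3 : ∀ b, β (A.coact m) b = sourceMapOp k H b • m := by
      intro b
      rw [← counit_coact_mul, LinearMap.rTensor_comp_apply]
      rfl
    have h4 : ∀ s : H ⊗[k] H, proj k H A.obj X (Ω (A.coact m) s) =
        proj k H A.obj X (m ⊗ₜ (LinearMap.mul' k H (TensorProduct.map LinearMap.id T
          (TensorProduct.comm k H H (LinearMap.lTensor H (targetMap k H) s))) • x)) := by
      intro s
      induction s using TensorProduct.induction_on with
      | zero => simp
      | add s t hs ht => simp only [map_add, add_smul, TensorProduct.tmul_add, hs, ht]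
      | tmul a b => simp [Ω, h3, proj_sourceMapOp_smul_tmul, mul_smul]
    rw [flipInv_flipAct, h1, h2, h4, lTensor_targetMap_comul_one, hS.inverse_mul_comm T hTS hST,
      sourceMapOp_one, one_smul]

/-- After projection, `ε̄_s(m₍₋₁₎) x ⊗ m₍₀₎ = x ⊗ ε_t(m₍₋₁₎) m₍₀₎ = x ⊗ m`; the last equality is
`targetMap_coact_mul` at `g = 1`, whence the factor `mulRight k 1`. -/
lemma proj_flipAct_flipInv (y : X ⊗[k] A.obj) :
    proj k H X A.obj (flipAct X A.coact (A.flipInv T X y)) = proj k H X A.obj y := by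
  induction y using TensorProduct.induction_on with
  | zero => simp
  | add s t hs ht => simp only [map_add, hs, ht]
  | tmul x m =>
    have h1 : LinearMap.mul' k H ∘ₗ TensorProduct.map LinearMap.id T ∘ₗ
        (TensorProduct.comm k H H).toLinearMap ∘ₗ Δ = sourceMapOp k H :=
      LinearMap.ext fun h => hS.inverse_mul_comm T hTS hST h
    have h2 : ∀ t : H ⊗[k] A.obj, proj k H X A.obj
        (actOn k H A.obj X (LinearMap.rTensor A.obj (sourceMapOp k H) t) x) =
          proj k H X A.obj (x ⊗ₜ TensorProduct.lift ((Algebra.lsmul k k A.obj).toLinearMap ∘ₗ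
            targetMap k H ∘ₗ LinearMap.mulRight k 1) t) := by
      intro t
      induction t using TensorProduct.induction_on with
      | zero => simp
      | add s t hs ht =>
        simp only [map_add, LinearMap.add_apply, TensorProduct.tmul_add, hs, ht]
      | tmul h n => simp [proj_sourceMapOp_smul_tmul]
    rw [flipAct_flipInv, h1, h2, targetMap_coact_mul, sourceMapOp_one, one_smul]

variable (X) in
/-- If the antipode is bijective, the half-braiding is bijective, with inverse
`x ⊗ m ↦ m₍₀₎ ⊗ S⁻¹(m₍₋₁₎) x`. -/
lemma halfBraid_bijective : Function.Bijective (A.halfBraid X) := by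
  refine Function.bijective_iff_has_inverse.2
    ⟨fun u => proj k H A.obj X (A.flipInv T X (incl k H X A.obj u)), fun u => ?_, fun u => ?_⟩
  · beta_reduce
    rw [← proj_incl u, incl_halfBraid_proj, A.proj_flipInv_flipAct hS hTS hST]
  · beta_reduce
    rw [halfBraid_proj, A.proj_flipAct_flipInv hS hTS hST, proj_incl]

end YetterDrinfeld

/-- Each object of the weak center comes from a Yetter-Drinfeld module, so bijectivity of
`halfBraid` suffices; the inverse is then automatically `H`-linear. -/
lemma WeakLeftCenter.isIso_σ {S : H →ₗ[k] H} (hS : IsAntipode k S) (hb : Function.Bijective S)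
    (B : WeakLeftCenter (LMod k H)) (X : LMod k H) : IsIso (B.σ X) := by
  rw [← B.toCenter_toYetterDrinfeld]
  let e := LinearEquiv.ofBijective S hb
  have h := B.toYetterDrinfeld.halfBraid_bijective X hS (T := e.symm) e.symm_apply_apply
    e.apply_symm_apply
  exact (LMod.isoOfEquiv (M := B.toYetterDrinfeld.obj ⊗ X) (N := X ⊗ B.toYetterDrinfeld.obj)
    (LinearEquiv.ofBijective (B.toYetterDrinfeld.halfBraid X) h)).isIso_hom

end

end WeakBialg

theorem theorem2p4 (k : Type u) (H : Type v) [CommRing k] [Ring H] [Algebra k H] [Coalgebra k H]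
    [WeakBialg.IsWeakBialgebra k H] :
    Nonempty (Cat.of (WeakBialg.YetterDrinfeld k H) ≅
        Cat.of (WeakBialg.WeakLeftCenter (WeakBialg.LMod k H))) ∧
      ∀ S : H →ₗ[k] H, WeakBialg.IsAntipode k S → Function.Bijective S →
        Nonempty (Cat.of (WeakBialg.YetterDrinfeld k H) ≅
          Cat.of (WeakBialg.LeftCenter (WeakBialg.LMod k H))) := by
  refine ⟨WeakBialg.nonempty_cat_iso_of_bijective_obj (WeakBialg.YetterDrinfeld.centerFunctor k H)
    WeakBialg.YetterDrinfeld.bijective_toCenter, fun S hS hb => ?_⟩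
  -- Invertibility lets the functor factor through the full subcategory, and bijectivity on objects
  -- is inherited.
  refine WeakBialg.nonempty_cat_iso_of_bijective_obj (ObjectProperty.lift _
    (WeakBialg.YetterDrinfeld.centerFunctor k H)
    fun A => WeakBialg.WeakLeftCenter.isIso_σ hS hb _) ⟨fun A B h => ?_, fun B => ?_⟩
  · exact WeakBialg.YetterDrinfeld.bijective_toCenter.1
      (congr_arg ObjectProperty.FullSubcategory.obj h)
  · obtain ⟨A, hA⟩ := WeakBialg.YetterDrinfeld.bijective_toCenter.2 B.obj
    exact ⟨A, ObjectProperty.FullSubcategory.ext hA⟩
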